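/- **Maximum principle.** Let $N\ge 2$, let $D\subset\mathbb R^N$ be a bounded domain (nonempty, open, connected) with smooth boundary $\Gamma=\partial D$ and outward unit normal $\mathbf n$, and let $\Gamma$ carry its surface measure. Let $\varepsilon\ge 0$ and $\delta>0$. Let $\tau:H^1(D)\to L^2(\Gamma)$ be the trace operator, with range $H^{1/2}(\Gamma)$, and set $$\mathcal V_\varepsilon=\{(u,v)\in H^1(D)\times V^\varepsilon_\Gamma:\ v=\tau u\},\qquad V^\varepsilon_\Gamma=H^1(\Gamma)\ \text{if } \varepsilon>0,\quad V^0_\Gamma=H^{1/2}(\Gamma).$$ Let $\mathcal C_\varepsilon(u,v)=(-\Delta u,\ \partial_{\mathbf n}u-\varepsilon\Delta_\Gamma v)$ be the linear operator on $L^2(D)\times L^2(\Gamma)$ given by the bilinear form on $\mathcal V_\varepsilon$: for $(u,v)\in\mathcal V_\varepsilon$ and $(a,b)\in L^2(D)\times L^2(\Gamma)$, $\mathcal C_\varepsilon(u,v)=(a,b)$ means $$\int_D\nabla u\cdot\nabla\varphi+\varepsilon\int_\Gamma\nabla_\Gamma v\cdot\nabla_\Gamma\psi=\int_D a\,\varphi+\int_\Gamma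 b\,\psi\qquad\forall(\varphi,\psi)\in\mathcal V_\varepsilon .$$ Then the resolvent $(I+\delta\mathcal C_\varepsilon)^{-1}$, which assigns to $(f,g)\in L^2(D)\times L^2(\Gamma)$ the solution $(u,v)$ of $(u,v)+\delta\,\mathcal C_\varepsilon(u,v)=(f,g)$, extends to exactly one bounded linear operator on $L^1(D)\times L^1(\Gamma)$, again denoted by $(I+\delta\mathcal C_\varepsilon)^{-1}$. Moreover, if $c_1,c_2>0$ and $(f,g)\in L^1(D)\times L^1(\Gamma)$ satisfy $f\le c_1$ a.e. on $D$ and $g\le c_2$ a.e. on $\Gamma$, then $(u,v):=(I+\delta\mathcal C_\varepsilon)^{-1}(f,g)$ satisfies $$u\le\max\{c_1,c_2\}\ \text{ a.e. on } D,\qquad v\le\max\{c_1,c_2\}\ \text{ a.e. on } \Gamma .$$ -/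

import Mathlib

open MeasureTheory Filter Topology Set
open scoped ContDiff ENNReal MeasureTheory

noncomputable section

namespace WentzellResolvent

variable {N : ℕ}

/-- Local description of the set `D` near a boundary point: on the open set `U` the function `r` is
smooth with nowhere vanishing gradient, and `D` is the set where `r` is negative. -/
structure IsLocalDefiningFunction (D U : Set (EuclideanSpace ℝ (Fin N)))
    (r : EuclideanSpace ℝ (Fin N) → ℝ) : Prop where
  isOpen : IsOpen U
  contDiffOn : ContDiffOn ℝ ∞ r U
  gradient_ne_zero : ∀ y ∈ U, gradient r y ≠ 0
  mem_iff : ∀ y ∈ U, (y ∈ D ↔ r y < 0)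

/-- A bounded domain (nonempty, open, connected) of `ℝ^N` with smooth boundary, lying locally on
one side of its boundary. -/
structure IsSmoothBoundedDomain (D : Set (EuclideanSpace ℝ (Fin N))) : Prop where
  isOpen : IsOpen D
  isConnected : IsConnected D
  isBounded : Bornology.IsBounded D
  smooth_boundary : ∀ x ∈ frontier D, ∃ U r, x ∈ U ∧ IsLocalDefiningFunction D U r

/-- `ν` is the outward unit normal to `D` at the boundary point `x`. -/
def IsOutwardUnitNormal (D : Set (EuclideanSpace ℝ (Fin N)))
    (x ν : EuclideanSpace ℝ (Fin N)) : Prop :=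
  x ∈ frontier D ∧ ∃ U r, x ∈ U ∧ IsLocalDefiningFunction D U r ∧
    ν = ‖gradient r x‖⁻¹ • gradient r x

open Classical in
/-- The outward unit normal field `n` on `Γ = ∂D` (it exists and is unique at every boundary point
of a smooth domain; the value `0` elsewhere is not used). -/
def outwardNormal (D : Set (EuclideanSpace ℝ (Fin N))) (x : EuclideanSpace ℝ (Fin N)) :
    EuclideanSpace ℝ (Fin N) :=
  if h : ∃ ν, IsOutwardUnitNormal D x ν then h.choose else 0

/-- Lebesgue measure on `D`. -/
def bulkMeasure (D : Set (EuclideanSpace ℝ (Fin N))) : Measure (EuclideanSpace ℝ (Fin N)) :=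
  volume.restrict D

/-- Surface measure on `Γ = ∂D`: the `(N-1)`-dimensional Hausdorff measure, normalised so that it is
Lebesgue measure on hyperplanes, restricted to `Γ`. -/
def surfaceMeasure (D : Set (EuclideanSpace ℝ (Fin N))) : Measure (EuclideanSpace ℝ (Fin N)) :=
  (μHE[N - 1] : Measure (EuclideanSpace ℝ (Fin N))).restrict (frontier D)

/-- The surface gradient `∇_Γ φ = ∇φ - (∇φ · n) n` of (the restriction to `Γ` of) a function `φ`
that is smooth on `ℝ^N`. -/
def tangentialGradient (D : Set (EuclideanSpace ℝ (Fin N))) (φ : EuclideanSpace ℝ (Fin N) → ℝ)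
    (x : EuclideanSpace ℝ (Fin N)) : EuclideanSpace ℝ (Fin N) :=
  gradient φ x - (inner ℝ (gradient φ x) (outwardNormal D x)) • outwardNormal D x

/-- `u ∈ H¹(D)` with weak gradient `p = ∇u`. -/
structure IsWeakGradient (D : Set (EuclideanSpace ℝ (Fin N))) (u : EuclideanSpace ℝ (Fin N) → ℝ)
    (p : EuclideanSpace ℝ (Fin N) → EuclideanSpace ℝ (Fin N)) : Prop where
  memLp : MemLp u 2 (bulkMeasure D)
  memLp_gradient : MemLp p 2 (bulkMeasure D)
  integral_eq : ∀ θ : EuclideanSpace ℝ (Fin N) → ℝ, ContDiff ℝ ∞ θ → HasCompactSupport θ →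
    tsupport θ ⊆ D →
    ∫ x, u x • gradient θ x ∂(bulkMeasure D) = -∫ x, θ x • p x ∂(bulkMeasure D)

/-- `u ∈ H¹(D)`. -/
def MemH1 (D : Set (EuclideanSpace ℝ (Fin N))) (u : EuclideanSpace ℝ (Fin N) → ℝ) : Prop :=
  ∃ p, IsWeakGradient D u p

/-- `v = τ u`, where `τ : H¹(D) → L²(Γ)` is the trace operator, that is, the continuous extension of
the restriction `φ ↦ φ|_Γ` from `C^∞(D̄)` (restrictions to `D̄` of smooth functions on `ℝ^N`),
which is dense in `H¹(D)`. -/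
def IsTrace (D : Set (EuclideanSpace ℝ (Fin N))) (u v : EuclideanSpace ℝ (Fin N) → ℝ) : Prop :=
  MemLp v 2 (surfaceMeasure D) ∧
  ∃ p, IsWeakGradient D u p ∧
    ∃ φ : ℕ → EuclideanSpace ℝ (Fin N) → ℝ, (∀ n, ContDiff ℝ ∞ (φ n)) ∧
      Tendsto (fun n => eLpNorm (φ n - u) 2 (bulkMeasure D)) atTop (𝓝 0) ∧
      Tendsto (fun n => eLpNorm (gradient (φ n) - p) 2 (bulkMeasure D)) atTop (𝓝 0) ∧
      Tendsto (fun n => eLpNorm (φ n - v) 2 (surfaceMeasure D)) atTop (𝓝 0)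

/-- `v ∈ H¹(Γ)` with surface gradient `w = ∇_Γ v`; here `H¹(Γ)` is the completion of `C^∞(Γ)` in the
norm `(‖v‖²_{L²(Γ)} + ‖∇_Γ v‖²_{L²(Γ)})^{1/2}`. Smooth functions on the compact hypersurface `Γ` are
the restrictions of smooth functions on `ℝ^N`. -/
def IsSurfaceGradient (D : Set (EuclideanSpace ℝ (Fin N))) (v : EuclideanSpace ℝ (Fin N) → ℝ)
    (w : EuclideanSpace ℝ (Fin N) → EuclideanSpace ℝ (Fin N)) : Prop :=
  MemLp v 2 (surfaceMeasure D) ∧ MemLp w 2 (surfaceMeasure D) ∧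
  ∃ φ : ℕ → EuclideanSpace ℝ (Fin N) → ℝ, (∀ n, ContDiff ℝ ∞ (φ n)) ∧
    Tendsto (fun n => eLpNorm (φ n - v) 2 (surfaceMeasure D)) atTop (𝓝 0) ∧
    Tendsto (fun n => eLpNorm (tangentialGradient D (φ n) - w) 2 (surfaceMeasure D)) atTop (𝓝 0)

/-- `v ∈ H¹(Γ)`. -/
def MemH1Boundary (D : Set (EuclideanSpace ℝ (Fin N))) (v : EuclideanSpace ℝ (Fin N) → ℝ) : Prop :=
  ∃ w, IsSurfaceGradient D v w

/-- `v ∈ H^{1/2}(Γ)`, the range of the trace operator on `H¹(D)`. -/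
def MemHHalfBoundary (D : Set (EuclideanSpace ℝ (Fin N))) (v : EuclideanSpace ℝ (Fin N) → ℝ) :
    Prop :=
  ∃ u, MemH1 D u ∧ IsTrace D u v

/-- `v ∈ V_Γ^ε`, where `V_Γ^ε = H¹(Γ)` if `ε > 0` and `V_Γ^0 = H^{1/2}(Γ)`. -/
def MemVBoundary (D : Set (EuclideanSpace ℝ (Fin N))) (ε : ℝ)
    (v : EuclideanSpace ℝ (Fin N) → ℝ) : Prop :=
  (0 < ε → MemH1Boundary D v) ∧ (ε = 0 → MemHHalfBoundary D v)

/-- `(u, v) ∈ 𝒱_ε = {(u, v) ∈ H¹(D) × V_Γ^ε : v = τ u}`. -/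
def MemV (D : Set (EuclideanSpace ℝ (Fin N))) (ε : ℝ)
    (u v : EuclideanSpace ℝ (Fin N) → ℝ) : Prop :=
  MemH1 D u ∧ MemVBoundary D ε v ∧ IsTrace D u v

/-- `(u, v) ∈ 𝒱_ε`, with `p = ∇u` and, if `ε > 0`, `w = ∇_Γ v`. If `ε = 0` there is no condition on
`w`, which then enters the bilinear form below only with the factor `ε = 0`. -/
def MemVWithGradients (D : Set (EuclideanSpace ℝ (Fin N))) (ε : ℝ)
    (u v : EuclideanSpace ℝ (Fin N) → ℝ)
    (p w : EuclideanSpace ℝ (Fin N) → EuclideanSpace ℝ (Fin N)) : Prop :=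
  MemV D ε u v ∧ IsWeakGradient D u p ∧ (0 < ε → IsSurfaceGradient D v w)

/-- The graph of the operator `𝒞_ε` on `L²(D) × L²(Γ)`: `(u, v) ∈ 𝒱_ε` and `𝒞_ε (u, v) = (a, b)`,
where `𝒞_ε` is given by the bilinear form
`⟨𝒞_ε (u, v), (φ, ψ)⟩ = ∫_D ∇u·∇φ + ε ∫_Γ ∇_Γ v·∇_Γ ψ` on `𝒱_ε`. Thus `a = -Δu` in the sense of
distributions on `D` (take `ψ = 0`), and `b = ∂_n u - ε Δ_Γ v` weakly on `Γ`. -/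
def IsCeps (D : Set (EuclideanSpace ℝ (Fin N))) (ε : ℝ)
    (u v a b : EuclideanSpace ℝ (Fin N) → ℝ) : Prop :=
  MemLp a 2 (bulkMeasure D) ∧ MemLp b 2 (surfaceMeasure D) ∧
  ∃ p w, MemVWithGradients D ε u v p w ∧
    ∀ φ ψ q z, MemVWithGradients D ε φ ψ q z →
      ∫ x, inner ℝ (p x) (q x) ∂(bulkMeasure D)
        + ε * ∫ x, inner ℝ (w x) (z x) ∂(surfaceMeasure D)
      = ∫ x, a x * φ x ∂(bulkMeasure D) + ∫ x, b x * ψ x ∂(surfaceMeasure D)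

/-- `(u, v) = (I + δ 𝒞_ε)⁻¹ (f, g)` in `L²(D) × L²(Γ)`, i.e. `(u, v) + δ 𝒞_ε (u, v) = (f, g)`. -/
def IsResolventL2 (D : Set (EuclideanSpace ℝ (Fin N))) (ε δ : ℝ)
    (f g u v : EuclideanSpace ℝ (Fin N) → ℝ) : Prop :=
  ∃ a b, IsCeps D ε u v a b ∧
    (∀ᵐ x ∂(bulkMeasure D), u x + δ * a x = f x) ∧
    (∀ᵐ x ∂(surfaceMeasure D), v x + δ * b x = g x)

/-- The space `L¹(D) × L¹(Γ)`. -/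
abbrev L1Space (D : Set (EuclideanSpace ℝ (Fin N))) : Type :=
  Lp ℝ 1 (bulkMeasure D) × Lp ℝ 1 (surfaceMeasure D)

/-- `R` is a bounded linear operator on `L¹(D) × L¹(Γ)` that extends the resolvent
`(I + δ 𝒞_ε)⁻¹` of `L²(D) × L²(Γ)`. -/
def IsResolventL1 (D : Set (EuclideanSpace ℝ (Fin N))) (ε δ : ℝ)
    (R : L1Space D →L[ℝ] L1Space D) : Prop :=
  ∀ F : L1Space D, MemLp F.1 2 (bulkMeasure D) → MemLp F.2 2 (surfaceMeasure D) →
    IsResolventL2 D ε δ F.1 F.2 (R F).1 (R F).2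

end WentzellResolvent

end

/-! Everything rests on one test identity. If `(u, v)` solves the resolvent equation in `L²` and `η`
is smooth, nondecreasing, with bounded derivative and `η 0 = 0`, then `(η(u), η(v))` is an
admissible test pair with gradients `η'(u)∇u` and `η'(v)∇_Γ v`. The bilinear form is then
nonnegative, so `∫_D (f - u) η(u) + ∫_Γ (g - v) η(v) ≥ 0`
(`IsResolventL2.integral_mul_comp_nonneg`).

Two choices of `η` do the work. If `η` vanishes up to `M` and is positive beyond, while `f, g ≤ M`,
both integrands are nonpositive, hence zero almost everywhere, which forces `u, v ≤ M`
(`IsResolventL2.ae_le`). If `η(s) = arctan(k s)`, a smooth stand-in for `π/2` times the sign,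
letting `k → ∞` bounds the `L¹` norms of `u` and `v` by `‖f‖₁ + ‖g‖₁`
(`IsResolventL2.eLpNorm_one_le`).

Existence in `L²` is the Riesz argument in projection form: the graph of `(u, v) ↦ (√δ ∇u, √(δε) ∇_Γ
v)` is a closed subspace of a Hilbert space, and projecting `(f, g, 0, 0)` onto it solves the
equation (`isResolventL2_resolventL2`). Conversely, every solution arises from this projection
(`IsResolventL2.eq_resolventL2`), which gives uniqueness.

The `L¹` bound extends the resolvent from the dense square integrable pairs to all of `L¹`,
uniquely. The upper bound survives the passage to the limit because truncation `s ↦ min s M` is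
continuous on `L¹`, preserves square integrability and fixes the given datum
(`IsResolventL1.ae_le`). -/

namespace WentzellResolvent

/-! ### Convergence in `L²` under composition with scalar functions. -/

section Lebesgue

variable {α F : Type*} [MeasurableSpace α] {μ : Measure α} [NormedAddCommGroup F]

/-- Dominated convergence to zero in `L²`. -/
theorem tendsto_eLpNorm_two_zero_of_dominated {f : ℕ → α → F} {g : α → F}
    (hf : ∀ n, AEStronglyMeasurable (f n) μ) (hg : MemLp g 2 μ)
    (hle : ∀ n, ∀ᵐ x ∂μ, ‖f n x‖ₑ ≤ ‖g x‖ₑ)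
    (hlim : ∀ᵐ x ∂μ, Tendsto (fun n => f n x) atTop (𝓝 0)) :
    Tendsto (fun n => eLpNorm (f n) 2 μ) atTop (𝓝 0) := by
  have h2 : (0 : ℝ) < (2 : ℝ≥0∞).toReal := by norm_num
  have key : Tendsto (fun n => ∫⁻ x, ‖f n x‖ₑ ^ (2 : ℝ≥0∞).toReal ∂μ) atTop
      (𝓝 (∫⁻ _, 0 ∂μ)) := by
    refine tendsto_lintegral_of_dominated_convergence'
      (fun x => ‖g x‖ₑ ^ (2 : ℝ≥0∞).toReal) (fun n => (hf n).enorm.pow_const _) (fun n => ?_)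
      ?_ ?_
    · filter_upwards [hle n] with x hx
      exact ENNReal.rpow_le_rpow hx h2.le
    · exact (lintegral_rpow_enorm_lt_top_of_eLpNorm_lt_top two_ne_zero ENNReal.ofNat_ne_top
        hg.2).ne
    · filter_upwards [hlim] with x hx
      have h := (ENNReal.continuous_rpow_const (y := (2 : ℝ≥0∞).toReal)).continuousAt.tendsto.comp
        ((continuous_enorm.tendsto (0 : F)).comp hx)
      simpa [Function.comp_def, ENNReal.zero_rpow_of_pos h2] using h
  have h3 := (ENNReal.continuous_rpow_const (y := 1 / (2 : ℝ≥0∞).toReal)).continuousAt.tendsto.comp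
    key
  simp only [lintegral_zero] at h3
  rw [ENNReal.zero_rpow_of_pos (by positivity)] at h3
  refine h3.congr fun n => ?_
  rw [eLpNorm_eq_lintegral_rpow_enorm_toReal two_ne_zero ENNReal.ofNat_ne_top]
  rfl

theorem tendsto_eLpNorm_comp_sub {φ : ℕ → α → ℝ} {u : α → ℝ} {η : ℝ → ℝ} {C : NNReal}
    (hη : LipschitzWith C η)
    (hφ : Tendsto (fun n => eLpNorm (φ n - u) 2 μ) atTop (𝓝 0)) :
    Tendsto (fun n => eLpNorm (η ∘ φ n - η ∘ u) 2 μ) atTop (𝓝 0) := by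
  have h := ENNReal.Tendsto.const_mul (a := ENNReal.ofReal C) hφ (Or.inr ENNReal.ofReal_ne_top)
  rw [mul_zero] at h
  refine tendsto_of_tendsto_of_tendsto_of_le_of_le tendsto_const_nhds h (fun n => zero_le)
    fun n => ?_
  refine eLpNorm_le_mul_eLpNorm_of_ae_le_mul (Eventually.of_forall fun x => ?_) 2
  simpa [dist_eq_norm] using hη.dist_le_mul (φ n x) (u x)

variable [NormedSpace ℝ F]

/-- This is the limit step of the chain rule, with `h` in the role of `η'`. The difference splits as
`h(φₙ)(Pₙ - p) + (h(φₙ) - h(u)) p`. The first term is controlled by the bound on `h`, the second by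
dominated convergence; `h` need not be Lipschitz. -/
theorem tendsto_eLpNorm_comp_smul_sub {φ : ℕ → α → ℝ} {u : α → ℝ} {P : ℕ → α → F} {p : α → F}
    {h : ℝ → ℝ} {C : ℝ} (hh : Continuous h) (hC : ∀ s, |h s| ≤ C)
    (hφm : ∀ n, AEStronglyMeasurable (φ n) μ) (hum : AEStronglyMeasurable u μ)
    (hPm : ∀ n, AEStronglyMeasurable (P n) μ) (hp : MemLp p 2 μ)
    (hφ : Tendsto (fun n => eLpNorm (φ n - u) 2 μ) atTop (𝓝 0))
    (hP : Tendsto (fun n => eLpNorm (P n - p) 2 μ) atTop (𝓝 0)) :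
    Tendsto (fun n => eLpNorm ((fun x => h (φ n x) • P n x) - fun x => h (u x) • p x) 2 μ)
      atTop (𝓝 0) := by
  have hhm : ∀ n, AEStronglyMeasurable (fun x => h (φ n x)) μ := fun n =>
    hh.comp_aestronglyMeasurable (hφm n)
  have hhu : AEStronglyMeasurable (fun x => h (u x)) μ := hh.comp_aestronglyMeasurable hum
  have h1 : Tendsto (fun n => eLpNorm (fun x => h (φ n x) • (P n x - p x)) 2 μ) atTop (𝓝 0) := by
    have h := ENNReal.Tendsto.const_mul (a := ENNReal.ofReal C) hP (Or.inr ENNReal.ofReal_ne_top)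
    rw [mul_zero] at h
    refine tendsto_of_tendsto_of_tendsto_of_le_of_le tendsto_const_nhds h (fun n => zero_le)
      fun n => ?_
    refine eLpNorm_le_mul_eLpNorm_of_ae_le_mul (Eventually.of_forall fun x => ?_) 2
    rw [norm_smul]
    exact mul_le_mul_of_nonneg_right (hC _) (norm_nonneg _)
  have h2 : Tendsto (fun n => eLpNorm (fun x => (h (φ n x) - h (u x)) • p x) 2 μ) atTop
      (𝓝 0) := by
    -- Convergence in `L²` yields almost everywhere convergence only along subsequences, so it is
    -- shown that every subsequence has a further one along which the claim holds; the dominating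
    -- function is `2C p`.
    refine tendsto_of_subseq_tendsto fun ns hns => ?_
    obtain ⟨ms, -, hms⟩ := (tendstoInMeasure_of_tendsto_eLpNorm two_ne_zero
      (fun n => hφm (ns n)) hum (hφ.comp hns)).exists_seq_tendsto_ae
    refine ⟨ms, tendsto_eLpNorm_two_zero_of_dominated (g := fun x => (2 * C) • p x)
      (fun n => ((hhm _).sub hhu).smul hp.1) (hp.const_smul (2 * C)) (fun n => ?_) ?_⟩
    · refine Eventually.of_forall fun x => enorm_le_iff_norm_le.2 ?_
      rw [norm_smul, norm_smul]
      refine mul_le_mul_of_nonneg_right ?_ (norm_nonneg _)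
      refine (norm_sub_le _ _).trans (le_trans ?_ (le_abs_self _))
      rw [two_mul]
      exact add_le_add (hC _) (hC _)
    · filter_upwards [hms] with x hx
      have h3 := ((hh.tendsto _).comp hx).sub (tendsto_const_nhds (x := h (u x)))
      simpa using h3.smul_const (p x)
  have h3 := h1.add h2
  rw [add_zero] at h3
  refine tendsto_of_tendsto_of_tendsto_of_le_of_le tendsto_const_nhds h3 (fun n => zero_le)
    fun n => ?_
  refine le_trans (le_of_eq ?_) (eLpNorm_add_le ((hhm n).smul ((hPm n).sub hp.1))
    (((hhm n).sub hhu).smul hp.1) one_le_two)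
  congr 1
  ext x
  simp [smul_sub, sub_smul]

end Lebesgue

end WentzellResolvent

/-! ### Limits of smooth functions together with a first order derivation. -/

namespace WentzellResolvent

variable {N : ℕ}

local notation "𝔼" => EuclideanSpace ℝ (Fin N)

/-- Algebraic properties of a first order derivation `G` on smooth functions, together with the
measurability of its values with respect to `μ`. -/
structure IsDerivation (μ : Measure (EuclideanSpace ℝ (Fin N)))
    (G : (EuclideanSpace ℝ (Fin N) → ℝ) → EuclideanSpace ℝ (Fin N) → EuclideanSpace ℝ (Fin N)) :
    Prop where
  aestronglyMeasurable : ∀ φ, ContDiff ℝ ∞ φ → AEStronglyMeasurable (G φ) μ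
  map_add : ∀ φ ψ, ContDiff ℝ ∞ φ → ContDiff ℝ ∞ ψ → G (φ + ψ) = G φ + G ψ
  map_smul : ∀ (c : ℝ) φ, ContDiff ℝ ∞ φ → G (c • φ) = c • G φ
  map_comp : ∀ (η : ℝ → ℝ) φ, ContDiff ℝ ∞ η → ContDiff ℝ ∞ φ →
    G (η ∘ φ) = fun x => deriv η (φ x) • G φ x

/-- `(u, p, v)` is a limit of `(φ, G φ, φ)` with `φ` smooth, in `L²(μ) × L²(μ) × L²(ν)`. -/
def IsSmoothLimit (μ ν : Measure (EuclideanSpace ℝ (Fin N)))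
    (G : (EuclideanSpace ℝ (Fin N) → ℝ) → EuclideanSpace ℝ (Fin N) → EuclideanSpace ℝ (Fin N))
    (u : EuclideanSpace ℝ (Fin N) → ℝ) (p : EuclideanSpace ℝ (Fin N) → EuclideanSpace ℝ (Fin N))
    (v : EuclideanSpace ℝ (Fin N) → ℝ) : Prop :=
  ∃ φ : ℕ → EuclideanSpace ℝ (Fin N) → ℝ, (∀ n, ContDiff ℝ ∞ (φ n)) ∧
    Tendsto (fun n => eLpNorm (φ n - u) 2 μ) atTop (𝓝 0) ∧
    Tendsto (fun n => eLpNorm (G (φ n) - p) 2 μ) atTop (𝓝 0) ∧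
    Tendsto (fun n => eLpNorm (φ n - v) 2 ν) atTop (𝓝 0)

theorem tendsto_eLpNorm_add {α F : Type*} [MeasurableSpace α] [NormedAddCommGroup F]
    {μ : Measure α} {f g : ℕ → α → F}
    (hfm : ∀ n, AEStronglyMeasurable (f n) μ) (hgm : ∀ n, AEStronglyMeasurable (g n) μ)
    (hf : Tendsto (fun n => eLpNorm (f n) 2 μ) atTop (𝓝 0))
    (hg : Tendsto (fun n => eLpNorm (g n) 2 μ) atTop (𝓝 0)) :
    Tendsto (fun n => eLpNorm (f n + g n) 2 μ) atTop (𝓝 0) := by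
  have h := hf.add hg
  rw [add_zero] at h
  exact tendsto_of_tendsto_of_tendsto_of_le_of_le tendsto_const_nhds h (fun n => zero_le)
    fun n => eLpNorm_add_le (hfm n) (hgm n) one_le_two

theorem tendsto_eLpNorm_const_smul {α F : Type*} [MeasurableSpace α] [NormedAddCommGroup F]
    [NormedSpace ℝ F] {μ : Measure α} {f : ℕ → α → F} (c : ℝ)
    (hf : Tendsto (fun n => eLpNorm (f n) 2 μ) atTop (𝓝 0)) :
    Tendsto (fun n => eLpNorm (c • f n) 2 μ) atTop (𝓝 0) := by
  have h := ENNReal.Tendsto.const_mul (a := ‖c‖ₑ) hf (Or.inr enorm_ne_top)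
  rw [mul_zero] at h
  exact h.congr fun n => (eLpNorm_const_smul c (f n) 2 μ).symm

theorem _root_.ContDiff.aestronglyMeasurable_top {φ : 𝔼 → ℝ} (hφ : ContDiff ℝ ∞ φ) (μ : Measure 𝔼) :
    AEStronglyMeasurable φ μ :=
  hφ.continuous.aestronglyMeasurable

namespace IsSmoothLimit

variable {μ ν : Measure (EuclideanSpace ℝ (Fin N))}
  {G : (EuclideanSpace ℝ (Fin N) → ℝ) → EuclideanSpace ℝ (Fin N) → EuclideanSpace ℝ (Fin N)}
  {u u' v v' : EuclideanSpace ℝ (Fin N) → ℝ}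
  {p p' : EuclideanSpace ℝ (Fin N) → EuclideanSpace ℝ (Fin N)}

theorem congr_ae (h : IsSmoothLimit μ ν G u p v) (hu : u =ᵐ[μ] u') (hp : p =ᵐ[μ] p')
    (hv : v =ᵐ[ν] v') : IsSmoothLimit μ ν G u' p' v' := by
  obtain ⟨φ, hφ, h1, h2, h3⟩ := h
  exact ⟨φ, hφ, h1.congr fun n => eLpNorm_congr_ae (EventuallyEq.rfl.sub hu),
    h2.congr fun n => eLpNorm_congr_ae (EventuallyEq.rfl.sub hp),
    h3.congr fun n => eLpNorm_congr_ae (EventuallyEq.rfl.sub hv)⟩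

theorem add (hG : IsDerivation μ G) (hu : AEStronglyMeasurable u μ)
    (hp : AEStronglyMeasurable p μ) (hv : AEStronglyMeasurable v ν)
    (hu' : AEStronglyMeasurable u' μ) (hp' : AEStronglyMeasurable p' μ)
    (hv' : AEStronglyMeasurable v' ν) (h : IsSmoothLimit μ ν G u p v)
    (h' : IsSmoothLimit μ ν G u' p' v') : IsSmoothLimit μ ν G (u + u') (p + p') (v + v') := by
  obtain ⟨φ, hφ, h1, h2, h3⟩ := h
  obtain ⟨ψ, hψ, k1, k2, k3⟩ := h'
  refine ⟨fun n => φ n + ψ n, fun n => (hφ n).add (hψ n), ?_, ?_, ?_⟩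
  · refine (tendsto_eLpNorm_add (fun n => ((hφ n).aestronglyMeasurable_top μ).sub hu)
      (fun n => ((hψ n).aestronglyMeasurable_top μ).sub hu') h1 k1).congr fun n => ?_
    rw [add_sub_add_comm]
  · refine (tendsto_eLpNorm_add (fun n => (hG.aestronglyMeasurable _ (hφ n)).sub hp)
      (fun n => (hG.aestronglyMeasurable _ (hψ n)).sub hp') h2 k2).congr fun n => ?_
    rw [hG.map_add _ _ (hφ n) (hψ n), add_sub_add_comm]
  · refine (tendsto_eLpNorm_add (fun n => ((hφ n).aestronglyMeasurable_top ν).sub hv)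
      (fun n => ((hψ n).aestronglyMeasurable_top ν).sub hv') h3 k3).congr fun n => ?_
    rw [add_sub_add_comm]

theorem smul (hG : IsDerivation μ G) (c : ℝ) (h : IsSmoothLimit μ ν G u p v) :
    IsSmoothLimit μ ν G (c • u) (c • p) (c • v) := by
  obtain ⟨φ, hφ, h1, h2, h3⟩ := h
  refine ⟨fun n => c • φ n, fun n => (hφ n).const_smul c, ?_, ?_, ?_⟩
  · exact (tendsto_eLpNorm_const_smul c h1).congr fun n => by rw [smul_sub]
  · exact (tendsto_eLpNorm_const_smul c h2).congr fun n => by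
      rw [hG.map_smul _ _ (hφ n), smul_sub]
  · exact (tendsto_eLpNorm_const_smul c h3).congr fun n => by rw [smul_sub]

/-- The chain rule holds for the smooth approximants, and both sides pass to the limit: `η` is
Lipschitz, while `η'` is bounded and continuous. -/
theorem comp (hG : IsDerivation μ G) {η : ℝ → ℝ} {C : NNReal} (hη : ContDiff ℝ ∞ η)
    (hC : ∀ s, |deriv η s| ≤ C) (hu : AEStronglyMeasurable u μ) (hp : MemLp p 2 μ)
    (h : IsSmoothLimit μ ν G u p v) :
    IsSmoothLimit μ ν G (η ∘ u) (fun x => deriv η (u x) • p x) (η ∘ v) := by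
  obtain ⟨φ, hφ, h1, h2, h3⟩ := h
  have hL : LipschitzWith C η := lipschitzWith_of_nnnorm_deriv_le (hη.differentiable (by simp)) hC
  refine ⟨fun n => η ∘ φ n, fun n => hη.comp (hφ n), tendsto_eLpNorm_comp_sub hL h1, ?_,
    tendsto_eLpNorm_comp_sub hL h3⟩
  refine (tendsto_eLpNorm_comp_smul_sub (hη.continuous_deriv (by simp)) hC
    (fun n => (hφ n).aestronglyMeasurable_top μ) hu
    (fun n => hG.aestronglyMeasurable _ (hφ n)) hp h1 h2).congr fun n => ?_
  rw [hG.map_comp _ _ hη (hφ n)]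

/-- Choosing one approximant for each tolerance `1/(n+1)` produces the required sequence. This is
the form in which diagonal arguments are run. -/
theorem of_forall_approx {u : 𝔼 → ℝ} {p : 𝔼 → 𝔼} {v : 𝔼 → ℝ}
    (h : ∀ r : ℝ≥0∞, 0 < r → ∃ φ : 𝔼 → ℝ, ContDiff ℝ ∞ φ ∧ eLpNorm (φ - u) 2 μ ≤ r ∧
      eLpNorm (G φ - p) 2 μ ≤ r ∧ eLpNorm (φ - v) 2 ν ≤ r) :
    IsSmoothLimit μ ν G u p v := by
  have hpos : ∀ n : ℕ, 0 < ((n : ℝ≥0∞) + 1)⁻¹ := fun n =>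
    ENNReal.inv_pos.2 (by finiteness)
  have hlim : Tendsto (fun n : ℕ => ((n : ℝ≥0∞) + 1)⁻¹) atTop (𝓝 0) := by
    have := (tendsto_add_atTop_iff_nat 1).2 ENNReal.tendsto_inv_nat_nhds_zero
    simpa using this
  choose φ hφ h1 h2 h3 using fun n : ℕ => h _ (hpos n)
  exact ⟨φ, hφ,
    tendsto_of_tendsto_of_tendsto_of_le_of_le tendsto_const_nhds hlim (fun n => zero_le) h1,
    tendsto_of_tendsto_of_tendsto_of_le_of_le tendsto_const_nhds hlim (fun n => zero_le) h2,
    tendsto_of_tendsto_of_tendsto_of_le_of_le tendsto_const_nhds hlim (fun n => zero_le) h3⟩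

/-- The smooth limits are closed under `L²` limits. -/
theorem of_tendsto (hG : IsDerivation μ G) {U : ℕ → 𝔼 → ℝ} {P : ℕ → 𝔼 → 𝔼} {V : ℕ → 𝔼 → ℝ}
    (hU : ∀ n, AEStronglyMeasurable (U n) μ) (hP : ∀ n, AEStronglyMeasurable (P n) μ)
    (hV : ∀ n, AEStronglyMeasurable (V n) ν) (hu : AEStronglyMeasurable u μ)
    (hp : AEStronglyMeasurable p μ) (hv : AEStronglyMeasurable v ν)
    (h : ∀ n, IsSmoothLimit μ ν G (U n) (P n) (V n))
    (h1 : Tendsto (fun n => eLpNorm (U n - u) 2 μ) atTop (𝓝 0))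
    (h2 : Tendsto (fun n => eLpNorm (P n - p) 2 μ) atTop (𝓝 0))
    (h3 : Tendsto (fun n => eLpNorm (V n - v) 2 ν) atTop (𝓝 0)) :
    IsSmoothLimit μ ν G u p v := by
  refine of_forall_approx fun r hr => ?_
  have hr2 : 0 < r / 2 := ENNReal.half_pos hr.ne'
  obtain ⟨n, hn1, hn2, hn3⟩ := ((h1.eventually_lt_const hr2).and
    ((h2.eventually_lt_const hr2).and (h3.eventually_lt_const hr2))).exists
  obtain ⟨φ, hφ, k1, k2, k3⟩ := h n
  obtain ⟨m, hm1, hm2, hm3⟩ := ((k1.eventually_lt_const hr2).and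
    ((k2.eventually_lt_const hr2).and (k3.eventually_lt_const hr2))).exists
  refine ⟨φ m, hφ m, ?_, ?_, ?_⟩
  · rw [← sub_add_sub_cancel _ (U n) u]
    refine (eLpNorm_add_le (((hφ m).aestronglyMeasurable_top μ).sub (hU n)) ((hU n).sub hu)
      one_le_two).trans ((add_le_add hm1.le hn1.le).trans (ENNReal.add_halves r).le)
  · rw [← sub_add_sub_cancel _ (P n) p]
    refine (eLpNorm_add_le ((hG.aestronglyMeasurable _ (hφ m)).sub (hP n)) ((hP n).sub hp)
      one_le_two).trans ((add_le_add hm2.le hn2.le).trans (ENNReal.add_halves r).le)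
  · rw [← sub_add_sub_cancel _ (V n) v]
    refine (eLpNorm_add_le (((hφ m).aestronglyMeasurable_top ν).sub (hV n)) ((hV n).sub hv)
      one_le_two).trans ((add_le_add hm3.le hn3.le).trans (ENNReal.add_halves r).le)

end IsSmoothLimit

end WentzellResolvent

/-! ### Gradients of smooth functions, the outward normal and the tangential gradient. -/

namespace WentzellResolvent

variable {N : ℕ}

theorem continuousOn_gradient {r : EuclideanSpace ℝ (Fin N) → ℝ}
    {U : Set (EuclideanSpace ℝ (Fin N))} (hU : IsOpen U) (hr : ContDiffOn ℝ ∞ r U) :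
    ContinuousOn (gradient r) U :=
  (InnerProductSpace.toDual ℝ (EuclideanSpace ℝ (Fin N))).symm.continuous.comp_continuousOn
    (hr.continuousOn_fderiv_of_isOpen hU (by simp))

theorem continuous_gradient {φ : EuclideanSpace ℝ (Fin N) → ℝ} (hφ : ContDiff ℝ ∞ φ) :
    Continuous (gradient φ) :=
  (InnerProductSpace.toDual ℝ (EuclideanSpace ℝ (Fin N))).symm.continuous.comp
    (hφ.continuous_fderiv (by simp))

theorem gradient_add_of_smooth {φ ψ : EuclideanSpace ℝ (Fin N) → ℝ} (hφ : ContDiff ℝ ∞ φ)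
    (hψ : ContDiff ℝ ∞ ψ) : gradient (φ + ψ) = gradient φ + gradient ψ := by
  ext1 x
  simp [gradient, fderiv_add (hφ.differentiable (by simp) x) (hψ.differentiable (by simp) x)]

theorem gradient_smul_of_smooth (c : ℝ) {φ : EuclideanSpace ℝ (Fin N) → ℝ}
    (hφ : ContDiff ℝ ∞ φ) : gradient (c • φ) = c • gradient φ := by
  ext1 x
  simp [gradient, fderiv_const_smul (hφ.differentiable (by simp) x)]

theorem gradient_comp_of_smooth {η : ℝ → ℝ} {φ : EuclideanSpace ℝ (Fin N) → ℝ}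
    (hη : ContDiff ℝ ∞ η) (hφ : ContDiff ℝ ∞ φ) :
    gradient (η ∘ φ) = fun x => deriv η (φ x) • gradient φ x := by
  ext1 x
  have h := ((hη.differentiable (by simp) (φ x)).hasDerivAt.comp_hasFDerivAt x
    (hφ.differentiable (by simp) x).hasFDerivAt).fderiv
  simp [gradient, h]

theorem isDerivation_gradient (μ : Measure (EuclideanSpace ℝ (Fin N))) :
    IsDerivation μ gradient where
  aestronglyMeasurable _ hφ := (continuous_gradient hφ).aestronglyMeasurable
  map_add _ _ hφ hψ := gradient_add_of_smooth hφ hψ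
  map_smul c _ hφ := gradient_smul_of_smooth c hφ
  map_comp _ _ hη hφ := gradient_comp_of_smooth hη hφ

/-- A defining function vanishes at boundary points. -/
theorem IsLocalDefiningFunction.eq_zero_of_mem_frontier {D U : Set (EuclideanSpace ℝ (Fin N))}
    {r : EuclideanSpace ℝ (Fin N) → ℝ} (h : IsLocalDefiningFunction D U r) (hD : IsOpen D)
    {x : EuclideanSpace ℝ (Fin N)} (hxU : x ∈ U) (hx : x ∈ frontier D) : r x = 0 := by
  rw [hD.frontier_eq] at hx
  refine le_antisymm ?_ (not_lt.1 fun h' => hx.2 ((h.mem_iff x hxU).2 h'))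
  by_contra! hpos
  have hc : ContinuousAt r x := (h.contDiffOn.continuousOn).continuousAt (h.isOpen.mem_nhds hxU)
  obtain ⟨y, ⟨hy1, hy2⟩, hyD⟩ := mem_closure_iff_nhds.1 hx.1 _
    (inter_mem (hc.eventually_const_lt hpos) (h.isOpen.mem_nhds hxU))
  exact absurd ((h.mem_iff y hy2).1 hyD) (not_lt.2 (le_of_lt hy1))

theorem IsLocalDefiningFunction.hasDerivAt_line {D U : Set (EuclideanSpace ℝ (Fin N))}
    {r : EuclideanSpace ℝ (Fin N) → ℝ} (h : IsLocalDefiningFunction D U r)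
    {x : EuclideanSpace ℝ (Fin N)} (hxU : x ∈ U) (e : EuclideanSpace ℝ (Fin N)) :
    HasDerivAt (fun t : ℝ => r (x + t • e)) (inner ℝ (gradient r x) e) 0 := by
  have hd : DifferentiableAt ℝ r x :=
    (h.contDiffOn.contDiffAt (h.isOpen.mem_nhds hxU)).differentiableAt (by simp)
  have hl := hd.hasFDerivAt.hasLineDerivAt e
  rw [inner_gradient_left]
  exact hl

/-- Two defining functions have gradients in the same half spaces. -/
theorem inner_gradient_nonpos {D U V : Set (EuclideanSpace ℝ (Fin N))}
    {r s : EuclideanSpace ℝ (Fin N) → ℝ} (hr : IsLocalDefiningFunction D U r)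
    (hs : IsLocalDefiningFunction D V s) (hD : IsOpen D) {x : EuclideanSpace ℝ (Fin N)}
    (hxU : x ∈ U) (hxV : x ∈ V) (hx : x ∈ frontier D) {e : EuclideanSpace ℝ (Fin N)}
    (he : inner ℝ (gradient r x) e < 0) : inner ℝ (gradient s x) e ≤ 0 := by
  have hline : Tendsto (fun t : ℝ => x + t • e) (𝓝[>] 0) (𝓝 x) := by
    have : Continuous fun t : ℝ => x + t • e := by fun_prop
    simpa using (this.tendsto 0).mono_left nhdsWithin_le_nhds
  have h1 : ∀ᶠ t : ℝ in 𝓝[>] 0, r (x + t • e) < 0 := by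
    have hsl := (hasDerivAt_iff_tendsto_slope.1 (hr.hasDerivAt_line hxU e)).mono_left
      (nhdsGT_le_nhdsNE 0)
    filter_upwards [hsl.eventually_lt_const he, self_mem_nhdsWithin] with t ht ht0
    simp only [slope_def_field, zero_smul, add_zero, sub_zero,
      hr.eq_zero_of_mem_frontier hD hxU hx] at ht
    by_contra! hcon
    exact absurd ht (not_lt.2 (div_nonneg hcon (le_of_lt ht0)))
  have h2 : ∀ᶠ t : ℝ in 𝓝[>] 0, s (x + t • e) < 0 := by
    filter_upwards [h1, hline (hr.isOpen.mem_nhds hxU), hline (hs.isOpen.mem_nhds hxV)]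
      with t ht htU htV
    exact (hs.mem_iff _ htV).1 ((hr.mem_iff _ htU).2 ht)
  have hsl := (hasDerivAt_iff_tendsto_slope.1 (hs.hasDerivAt_line hxV e)).mono_left
    (nhdsGT_le_nhdsNE 0)
  refine le_of_tendsto hsl ?_
  filter_upwards [h2, self_mem_nhdsWithin] with t ht ht0
  simp only [slope_def_field, zero_smul, add_zero, sub_zero,
    hs.eq_zero_of_mem_frontier hD hxV hx]
  exact div_nonpos_of_nonpos_of_nonneg ht.le (le_of_lt ht0)

/-- The inclusion extends to closed half spaces by perturbing `e` to `e - t a`. Testing with the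
component of `b` orthogonal to `a`, and with `-a`, gives equality in Cauchy–Schwarz, so `a` and `b`
are positive multiples of each other. -/
theorem normalize_eq_of_halfSpace {H : Type*} [NormedAddCommGroup H] [InnerProductSpace ℝ H]
    {a b : H} (ha : a ≠ 0) (hb : b ≠ 0)
    (h : ∀ e : H, inner ℝ a e < 0 → inner ℝ b e ≤ 0) : ‖a‖⁻¹ • a = ‖b‖⁻¹ • b := by
  have hle : ∀ e : H, inner ℝ a e ≤ 0 → inner ℝ b e ≤ 0 := by
    intro e he
    have hc : Tendsto (fun t : ℝ => inner ℝ b (e - t • a)) (𝓝[>] 0) (𝓝 (inner ℝ b e)) := by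
      have : Continuous fun t : ℝ => inner ℝ b (e - t • a) := by fun_prop
      simpa using (this.tendsto 0).mono_left nhdsWithin_le_nhds
    refine le_of_tendsto hc ?_
    filter_upwards [self_mem_nhdsWithin] with t ht
    refine h _ ?_
    rw [inner_sub_right, inner_smul_right, real_inner_self_eq_norm_sq]
    have : 0 < t * ‖a‖ ^ 2 := mul_pos ht (by positivity)
    linarith
  have ha' : 0 < ‖a‖ := norm_pos_iff.2 ha
  have hb' : 0 < ‖b‖ := norm_pos_iff.2 hb
  have key : ‖a‖ * ‖b‖ ≤ inner ℝ a b := by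
    -- The test vector is orthogonal to `a`, and the resulting inequality reads `‖b‖² ≤ ⟨a, b⟩² /
    -- ‖a‖²`.
    have := hle (b - (inner ℝ a b / ‖a‖ ^ 2) • a) (by
      rw [inner_sub_right, inner_smul_right, real_inner_self_eq_norm_sq,
        div_mul_cancel₀ _ (by positivity), sub_self])
    rw [inner_sub_right, inner_smul_right, real_inner_self_eq_norm_sq, real_inner_comm a b,
      div_mul_eq_mul_div, sub_nonpos, le_div_iff₀ (by positivity)] at this
    have hnn : 0 ≤ inner ℝ a b := by
      have := hle (-a) (by rw [inner_neg_right, real_inner_self_eq_norm_sq]; nlinarith)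
      rw [inner_neg_right, real_inner_comm] at this
      linarith
    exact abs_le_of_sq_le_sq' (by rw [mul_pow]; nlinarith) hnn |>.2
  have heq : inner ℝ a b = ‖a‖ * ‖b‖ := le_antisymm (real_inner_le_norm a b) key
  rw [inner_eq_norm_mul_iff_real] at heq
  rw [inv_smul_eq_iff₀ ha'.ne', smul_comm, eq_comm, inv_smul_eq_iff₀ hb'.ne', heq]

/-- The normal is defined by a choice of defining function; the half space comparison shows that the
choice is immaterial, so any local defining function computes it. -/
theorem outwardNormal_eq {D U : Set (EuclideanSpace ℝ (Fin N))}
    {r : EuclideanSpace ℝ (Fin N) → ℝ} (hr : IsLocalDefiningFunction D U r) (hD : IsOpen D)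
    {x : EuclideanSpace ℝ (Fin N)} (hxU : x ∈ U) (hx : x ∈ frontier D) :
    outwardNormal D x = ‖gradient r x‖⁻¹ • gradient r x := by
  have hex : ∃ ν, IsOutwardUnitNormal D x ν := ⟨_, hx, U, r, hxU, hr, rfl⟩
  rw [outwardNormal, dif_pos hex]
  obtain ⟨-, V, s, hxV, hs, hν⟩ := hex.choose_spec
  rw [hν]
  exact normalize_eq_of_halfSpace (hs.gradient_ne_zero x hxV) (hr.gradient_ne_zero x hxU)
    fun e he => inner_gradient_nonpos hs hr hD hxV hxU hx he

/-- Near a boundary point a single defining function computes the normal at all nearby boundary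
points. Continuity is what makes tangential gradients measurable for the surface measure. -/
theorem IsSmoothBoundedDomain.continuousOn_outwardNormal {D : Set (EuclideanSpace ℝ (Fin N))}
    (hD : IsSmoothBoundedDomain D) : ContinuousOn (outwardNormal D) (frontier D) := by
  intro x hx
  obtain ⟨U, r, hxU, hr⟩ := hD.smooth_boundary x hx
  have hU : U ∈ 𝓝 x := hr.isOpen.mem_nhds hxU
  have hc : ContinuousAt (fun y => ‖gradient r y‖⁻¹ • gradient r y) x := by
    have hg := (continuousOn_gradient hr.isOpen hr.contDiffOn).continuousAt hU
    exact (hg.norm.inv₀ (norm_ne_zero_iff.2 (hr.gradient_ne_zero x hxU))).smul hg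
  refine hc.continuousWithinAt.congr_of_eventuallyEq ?_ (outwardNormal_eq hr hD.isOpen hxU hx)
  filter_upwards [self_mem_nhdsWithin, mem_nhdsWithin_of_mem_nhds hU] with y hy hyU
  exact outwardNormal_eq hr hD.isOpen hyU hy

theorem IsSmoothBoundedDomain.aestronglyMeasurable_tangentialGradient
    {D : Set (EuclideanSpace ℝ (Fin N))} (hD : IsSmoothBoundedDomain D)
    {φ : EuclideanSpace ℝ (Fin N) → ℝ} (hφ : ContDiff ℝ ∞ φ) :
    AEStronglyMeasurable (tangentialGradient D φ) (surfaceMeasure D) := by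
  have hn := hD.continuousOn_outwardNormal
  have hg := (continuous_gradient hφ).continuousOn (s := frontier D)
  have hc : ContinuousOn (tangentialGradient D φ) (frontier D) := hg.sub ((ContinuousOn.inner (𝕜 := ℝ) hg hn).smul hn)
  rw [surfaceMeasure]
  exact hc.aestronglyMeasurable isClosed_frontier.measurableSet

theorem tangentialGradient_add_of_smooth (D : Set (EuclideanSpace ℝ (Fin N)))
    {φ ψ : EuclideanSpace ℝ (Fin N) → ℝ} (hφ : ContDiff ℝ ∞ φ) (hψ : ContDiff ℝ ∞ ψ) :
    tangentialGradient D (φ + ψ) = tangentialGradient D φ + tangentialGradient D ψ := by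
  ext1 x
  rw [Pi.add_apply]
  simp only [tangentialGradient]
  rw [gradient_add_of_smooth hφ hψ, Pi.add_apply, inner_add_left, add_smul, add_sub_add_comm]

theorem tangentialGradient_smul_of_smooth (D : Set (EuclideanSpace ℝ (Fin N))) (c : ℝ)
    {φ : EuclideanSpace ℝ (Fin N) → ℝ} (hφ : ContDiff ℝ ∞ φ) :
    tangentialGradient D (c • φ) = c • tangentialGradient D φ := by
  ext1 x
  rw [Pi.smul_apply]
  simp only [tangentialGradient]
  rw [gradient_smul_of_smooth c hφ, Pi.smul_apply, real_inner_smul_left, smul_sub, smul_smul]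

theorem tangentialGradient_comp_of_smooth (D : Set (EuclideanSpace ℝ (Fin N))) {η : ℝ → ℝ}
    {φ : EuclideanSpace ℝ (Fin N) → ℝ} (hη : ContDiff ℝ ∞ η) (hφ : ContDiff ℝ ∞ φ) :
    tangentialGradient D (η ∘ φ) = fun x => deriv η (φ x) • tangentialGradient D φ x := by
  ext1 x
  simp only [tangentialGradient]
  rw [gradient_comp_of_smooth hη hφ, real_inner_smul_left, smul_sub, smul_smul]

theorem IsSmoothBoundedDomain.isDerivation_tangentialGradient
    {D : Set (EuclideanSpace ℝ (Fin N))} (hD : IsSmoothBoundedDomain D) :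
    IsDerivation (surfaceMeasure D) (tangentialGradient D) where
  aestronglyMeasurable _ hφ := hD.aestronglyMeasurable_tangentialGradient hφ
  map_add _ _ hφ hψ := tangentialGradient_add_of_smooth D hφ hψ
  map_smul c _ hφ := tangentialGradient_smul_of_smooth D c hφ
  map_comp _ _ hη hφ := tangentialGradient_comp_of_smooth D hη hφ

end WentzellResolvent

/-! ### Weak gradients, and a description of `𝒱_ε` by smooth approximation. -/

namespace WentzellResolvent

variable {N : ℕ}

theorem hasCompactSupport_gradient {θ : EuclideanSpace ℝ (Fin N) → ℝ} (hθ : HasCompactSupport θ) :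
    HasCompactSupport (gradient θ) :=
  (hθ.fderiv (𝕜 := ℝ)).comp_left (map_zero (InnerProductSpace.toDual ℝ _).symm)

theorem gradient_eq_zero_of_notMem_tsupport {θ : EuclideanSpace ℝ (Fin N) → ℝ}
    {x : EuclideanSpace ℝ (Fin N)} (hx : x ∉ tsupport θ) : gradient θ x = 0 := by
  simp [gradient, fderiv_of_notMem_tsupport ℝ hx]

/-- Pairing with a fixed vector `e` reduces the vector identity to scalar integration by parts for
directional derivatives; the compact support of `θ` supplies integrability and removes boundary
terms. -/
theorem integral_smul_gradient_eq_neg {φ θ : EuclideanSpace ℝ (Fin N) → ℝ} (hφ : ContDiff ℝ ∞ φ)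
    (hθ : ContDiff ℝ ∞ θ) (hc : HasCompactSupport θ) :
    ∫ x, φ x • gradient θ x = -∫ x, θ x • gradient φ x := by
  have hI1 : Integrable (fun x => φ x • gradient θ x) :=
    (hφ.continuous.smul (continuous_gradient hθ)).integrable_of_hasCompactSupport
      (hasCompactSupport_gradient hc).smul_left
  have hI2 : Integrable (fun x => θ x • gradient φ x) :=
    (hθ.continuous.smul (continuous_gradient hφ)).integrable_of_hasCompactSupport
      hc.smul_right
  refine ext_inner_right ℝ fun e => ?_
  rw [inner_neg_left, real_inner_comm, real_inner_comm e, ← integral_inner hI1,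
    ← integral_inner hI2]
  have h1 : ∀ x, inner ℝ e (φ x • gradient θ x) = φ x * fderiv ℝ θ x e := fun x => by
    rw [real_inner_comm, real_inner_smul_left, inner_gradient_left]
  have h2 : ∀ x, inner ℝ e (θ x • gradient φ x) = fderiv ℝ φ x e * θ x := fun x => by
    rw [real_inner_comm, real_inner_smul_left, inner_gradient_left, mul_comm]
  have k1 := hI1.const_inner (𝕜 := ℝ) e
  have k2 := hI2.const_inner (𝕜 := ℝ) e
  simp only [h1, h2] at k1 k2 ⊢
  exact integral_mul_fderiv_eq_neg_fderiv_mul_of_integrable k2 k1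
    ((hφ.continuous.mul hθ.continuous).integrable_of_hasCompactSupport hc.mul_left)
    (fun x _ => hφ.differentiable (by simp) x) (fun x _ => hθ.differentiable (by simp) x)

theorem integral_bulkMeasure_smul_gradient_eq_neg {D : Set (EuclideanSpace ℝ (Fin N))}
    {φ θ : EuclideanSpace ℝ (Fin N) → ℝ} (hφ : ContDiff ℝ ∞ φ)
    (hθ : ContDiff ℝ ∞ θ) (hc : HasCompactSupport θ) (hs : tsupport θ ⊆ D) :
    ∫ x, φ x • gradient θ x ∂(bulkMeasure D) = -∫ x, θ x • gradient φ x ∂(bulkMeasure D) := by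
  rw [bulkMeasure, setIntegral_eq_integral_of_forall_compl_eq_zero,
    setIntegral_eq_integral_of_forall_compl_eq_zero, integral_smul_gradient_eq_neg hφ hθ hc]
  · intro x hx
    rw [image_eq_zero_of_notMem_tsupport fun h => hx (hs h), zero_smul]
  · intro x hx
    rw [gradient_eq_zero_of_notMem_tsupport fun h => hx (hs h), smul_zero]

/-- Writing `fₙgₙ - f₀g₀` as `(fₙ - f₀)(gₙ - g₀) + (fₙ - f₀)g₀ + f₀(gₙ - g₀)` and applying Hölder to
each term avoids a uniform bound on the norms of `gₙ`. -/
theorem tendsto_integral_smul_of_tendsto_eLpNorm {α F : Type*} [MeasurableSpace α]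
    [NormedAddCommGroup F] [NormedSpace ℝ F] {μ : Measure α} {f : ℕ → α → ℝ}
    {g : ℕ → α → F} {f₀ : α → ℝ} {g₀ : α → F} (hf : ∀ n, AEStronglyMeasurable (f n) μ)
    (hg : ∀ n, AEStronglyMeasurable (g n) μ) (hf₀ : MemLp f₀ 2 μ) (hg₀ : MemLp g₀ 2 μ)
    (hf' : Tendsto (fun n => eLpNorm (f n - f₀) 2 μ) atTop (𝓝 0))
    (hg' : Tendsto (fun n => eLpNorm (g n - g₀) 2 μ) atTop (𝓝 0)) :
    Tendsto (fun n => ∫ x, f n x • g n x ∂μ) atTop (𝓝 (∫ x, f₀ x • g₀ x ∂μ)) := by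
  -- The terms of the sequences are not assumed square integrable; a finite distance to the limit
  -- makes them so from some index on.
  have hfin : ∀ᶠ n in atTop, MemLp (f n) 2 μ ∧ MemLp (g n) 2 μ := by
    filter_upwards [hf'.eventually_lt_const ENNReal.zero_lt_top,
      hg'.eventually_lt_const ENNReal.zero_lt_top] with n h1 h2
    have k1 : MemLp (f n - f₀) 2 μ := ⟨(hf n).sub hf₀.1, h1⟩
    have k2 : MemLp (g n - g₀) 2 μ := ⟨(hg n).sub hg₀.1, h2⟩
    exact ⟨by simpa using k1.add hf₀, by simpa using k2.add hg₀⟩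
  refine tendsto_integral_of_L1' _ (hf₀.1.smul hg₀.1) ?_ ?_
  · filter_upwards [hfin] with n hn
    exact memLp_one_iff_integrable.1 (hn.2.smul hn.1)
  · have hb : Tendsto (fun n => eLpNorm (f n - f₀) 2 μ * eLpNorm (g n - g₀) 2 μ
        + eLpNorm (f n - f₀) 2 μ * eLpNorm g₀ 2 μ + eLpNorm f₀ 2 μ * eLpNorm (g n - g₀) 2 μ)
        atTop (𝓝 0) := by
      have h1 := ENNReal.Tendsto.mul hf' (Or.inr ENNReal.zero_ne_top) hg'
        (Or.inr ENNReal.zero_ne_top)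
      have h2 := ENNReal.Tendsto.mul_const (b := eLpNorm g₀ 2 μ) hf' (Or.inr hg₀.2.ne)
      have h3 := ENNReal.Tendsto.const_mul (a := eLpNorm f₀ 2 μ) hg' (Or.inr hf₀.2.ne)
      simpa using (h1.add h2).add h3
    refine tendsto_of_tendsto_of_tendsto_of_le_of_le tendsto_const_nhds hb (fun n => zero_le)
      fun n => ?_
    have hsplit : ((fun x => f n x • g n x) - fun x => f₀ x • g₀ x)
        = (f n - f₀) • (g n - g₀) + (f n - f₀) • g₀ + f₀ • (g n - g₀) := by
      ext x
      simp only [Pi.sub_apply, Pi.add_apply, Pi.smul_apply', smul_sub, sub_smul]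
      abel
    have m1 := (hf n).sub hf₀.1
    have m2 := (hg n).sub hg₀.1
    refine (congrArg (fun h => eLpNorm h 1 μ) hsplit).le.trans ?_
    refine (eLpNorm_add_le ((m1.smul m2).add (m1.smul hg₀.1)) (hf₀.1.smul m2) le_rfl).trans ?_
    refine add_le_add ((eLpNorm_add_le (m1.smul m2) (m1.smul hg₀.1) le_rfl).trans
      (add_le_add ?_ ?_)) ?_
    · exact eLpNorm_smul_le_mul_eLpNorm m2 m1
    · exact eLpNorm_smul_le_mul_eLpNorm hg₀.1 m1
    · exact eLpNorm_smul_le_mul_eLpNorm m2 hf₀.1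

/-- Integration by parts holds for each approximant, and both integrals converge against a fixed
test function. -/
theorem IsSmoothLimit.isWeakGradient {D : Set (EuclideanSpace ℝ (Fin N))}
    {ν : Measure (EuclideanSpace ℝ (Fin N))} {u v : EuclideanSpace ℝ (Fin N) → ℝ}
    {p : EuclideanSpace ℝ (Fin N) → EuclideanSpace ℝ (Fin N)}
    (hu : MemLp u 2 (bulkMeasure D)) (hp : MemLp p 2 (bulkMeasure D))
    (h : IsSmoothLimit (bulkMeasure D) ν gradient u p v) : IsWeakGradient D u p := by
  refine ⟨hu, hp, fun θ hθ hc hs => ?_⟩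
  obtain ⟨φ, hφ, h1, h2, -⟩ := h
  have hconst : ∀ {F : Type} [NormedAddCommGroup F] (f : EuclideanSpace ℝ (Fin N) → F),
      Tendsto (fun _ : ℕ => eLpNorm (f - f) 2 (bulkMeasure D)) atTop (𝓝 0) := by
    intro F _ f
    simp
  have hmθ : MemLp θ 2 (bulkMeasure D) :=
    (hθ.continuous.memLp_of_hasCompactSupport hc).restrict D
  have hmg : MemLp (gradient θ) 2 (bulkMeasure D) :=
    ((continuous_gradient hθ).memLp_of_hasCompactSupport
      (hasCompactSupport_gradient hc)).restrict D
  have l1 := tendsto_integral_smul_of_tendsto_eLpNorm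
    (fun n => (hφ n).aestronglyMeasurable_top _) (fun _ => hmg.1) hu hmg h1 (hconst _)
  have l2 := (tendsto_integral_smul_of_tendsto_eLpNorm (fun _ => hmθ.1)
    (fun n => (continuous_gradient (hφ n)).aestronglyMeasurable) hmθ hp (hconst _) h2).neg
  refine tendsto_nhds_unique l1 (l2.congr fun n => ?_)
  exact (integral_bulkMeasure_smul_gradient_eq_neg (hφ n) hθ hc hs).symm

/-- The difference of two weak gradients annihilates all test functions, so it vanishes by the
fundamental lemma of the calculus of variations. -/
theorem IsWeakGradient.ae_unique {D : Set (EuclideanSpace ℝ (Fin N))} (hD : IsOpen D)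
    {u : EuclideanSpace ℝ (Fin N) → ℝ}
    {p q : EuclideanSpace ℝ (Fin N) → EuclideanSpace ℝ (Fin N)}
    (hp : IsWeakGradient D u p) (hq : IsWeakGradient D u q) : p =ᵐ[bulkMeasure D] q := by
  have hpq : MemLp (p - q) 2 (bulkMeasure D) := hp.memLp_gradient.sub hq.memLp_gradient
  have : IsLocallyFiniteMeasure (bulkMeasure D) :=
    inferInstanceAs (IsLocallyFiniteMeasure (volume.restrict D))
  have h := hD.ae_eq_zero_of_integral_contDiff_smul_eq_zero (μ := bulkMeasure D) (f := p - q)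
    ((hpq.locallyIntegrable one_le_two).locallyIntegrableOn D) fun θ hθ hc hs => ?_
  · have hmem : ∀ᵐ x ∂(bulkMeasure D), x ∈ D := ae_restrict_mem hD.measurableSet
    filter_upwards [h, hmem] with x hx hxD
    exact sub_eq_zero.1 (hx hxD)
  · have hmθ : MemLp θ 2 (bulkMeasure D) :=
      (hθ.continuous.memLp_of_hasCompactSupport hc).restrict D
    have i1 : Integrable (fun x => θ x • p x) (bulkMeasure D) :=
      memLp_one_iff_integrable.1 (hp.memLp_gradient.smul hmθ)
    have i2 : Integrable (fun x => θ x • q x) (bulkMeasure D) :=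
      memLp_one_iff_integrable.1 (hq.memLp_gradient.smul hmθ)
    simp only [Pi.sub_apply, smul_sub]
    rw [integral_sub i1 i2, sub_eq_zero]
    have e1 := hp.integral_eq θ hθ hc hs
    have e2 := hq.integral_eq θ hθ hc hs
    exact neg_injective (e1.symm.trans e2)

/-- Taking the zero measure for the third component makes its convergence vacuous, so one notion of
smooth limit serves both the bulk and the surface. -/
theorem isSurfaceGradient_iff {D : Set (EuclideanSpace ℝ (Fin N))}
    {v : EuclideanSpace ℝ (Fin N) → ℝ}
    {w : EuclideanSpace ℝ (Fin N) → EuclideanSpace ℝ (Fin N)} :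
    IsSurfaceGradient D v w ↔ MemLp v 2 (surfaceMeasure D) ∧ MemLp w 2 (surfaceMeasure D) ∧
      IsSmoothLimit (surfaceMeasure D) 0 (tangentialGradient D) v w 0 := by
  simp [IsSurfaceGradient, IsSmoothLimit]

/-- The trace condition carries its own approximated gradient, which agrees with `p` by uniqueness
of weak gradients. Conversely the smooth limit already yields the weak gradient and the trace, and
hence the `H^{1/2}` condition. All stability properties of `𝒱_ε` are proved in this form. -/
theorem memVWithGradients_iff {D : Set (EuclideanSpace ℝ (Fin N))} (hD : IsOpen D) {ε : ℝ}
    {u v : EuclideanSpace ℝ (Fin N) → ℝ}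
    {p w : EuclideanSpace ℝ (Fin N) → EuclideanSpace ℝ (Fin N)} :
    MemVWithGradients D ε u v p w ↔ MemLp u 2 (bulkMeasure D) ∧ MemLp p 2 (bulkMeasure D) ∧
      MemLp v 2 (surfaceMeasure D) ∧
      IsSmoothLimit (bulkMeasure D) (surfaceMeasure D) gradient u p v ∧
      (0 < ε → MemLp w 2 (surfaceMeasure D) ∧
        IsSmoothLimit (surfaceMeasure D) 0 (tangentialGradient D) v w 0) := by
  constructor
  · rintro ⟨⟨-, -, hv, p', hp', φ, hφ⟩, hp, hw⟩
    have hl : IsSmoothLimit (bulkMeasure D) (surfaceMeasure D) gradient u p' v := ⟨φ, hφ⟩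
    exact ⟨hp.memLp, hp.memLp_gradient, hv,
      hl.congr_ae EventuallyEq.rfl (hp'.ae_unique hD hp) EventuallyEq.rfl,
      fun hε => (isSurfaceGradient_iff.1 (hw hε)).2⟩
  · rintro ⟨hu, hp, hv, hl, hw⟩
    have hg := hl.isWeakGradient hu hp
    have hw' : 0 < ε → IsSurfaceGradient D v w := fun hε =>
      isSurfaceGradient_iff.2 ⟨hv, hw hε⟩
    have htr : IsTrace D u v := ⟨hv, p, hg, hl⟩
    exact ⟨⟨⟨p, hg⟩, ⟨fun hε => ⟨w, hw' hε⟩, fun _ => ⟨u, ⟨p, hg⟩, htr⟩⟩, htr⟩, hg, hw'⟩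

end WentzellResolvent

/-! ### Stability of `𝒱_ε` and its closed graph in the energy space. -/

namespace WentzellResolvent

variable {N : ℕ} {D : Set (EuclideanSpace ℝ (Fin N))} {ε : ℝ}

namespace MemVWithGradients

variable {u u' v v' : EuclideanSpace ℝ (Fin N) → ℝ}
  {p p' w w' : EuclideanSpace ℝ (Fin N) → EuclideanSpace ℝ (Fin N)}

theorem congr_ae (hD : IsOpen D) (h : MemVWithGradients D ε u v p w)
    (hu : u =ᵐ[bulkMeasure D] u') (hv : v =ᵐ[surfaceMeasure D] v')
    (hp : p =ᵐ[bulkMeasure D] p') (hw : 0 < ε → w =ᵐ[surfaceMeasure D] w') :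
    MemVWithGradients D ε u' v' p' w' := by
  rw [memVWithGradients_iff hD] at h ⊢
  obtain ⟨h1, h2, h3, h4, h5⟩ := h
  exact ⟨h1.ae_eq hu, h2.ae_eq hp, h3.ae_eq hv, h4.congr_ae hu hp hv, fun hε =>
    ⟨(h5 hε).1.ae_eq (hw hε), (h5 hε).2.congr_ae hv (hw hε) EventuallyEq.rfl⟩⟩

theorem add (hD : IsSmoothBoundedDomain D) (h : MemVWithGradients D ε u v p w)
    (h' : MemVWithGradients D ε u' v' p' w') :
    MemVWithGradients D ε (u + u') (v + v') (p + p') (w + w') := by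
  rw [memVWithGradients_iff hD.isOpen] at h h' ⊢
  obtain ⟨h1, h2, h3, h4, h5⟩ := h
  obtain ⟨k1, k2, k3, k4, k5⟩ := h'
  refine ⟨h1.add k1, h2.add k2, h3.add k3, h4.add (isDerivation_gradient _) h1.1 h2.1 h3.1
    k1.1 k2.1 k3.1 k4, fun hε => ⟨(h5 hε).1.add (k5 hε).1, ?_⟩⟩
  have := (h5 hε).2.add hD.isDerivation_tangentialGradient h3.1 (h5 hε).1.1
    (aestronglyMeasurable_zero_measure _) k3.1 (k5 hε).1.1 (aestronglyMeasurable_zero_measure _) (k5 hε).2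
  simpa using this

theorem smul (hD : IsSmoothBoundedDomain D) (c : ℝ) (h : MemVWithGradients D ε u v p w) :
    MemVWithGradients D ε (c • u) (c • v) (c • p) (c • w) := by
  rw [memVWithGradients_iff hD.isOpen] at h ⊢
  obtain ⟨h1, h2, h3, h4, h5⟩ := h
  refine ⟨h1.const_smul c, h2.const_smul c, h3.const_smul c,
    h4.smul (isDerivation_gradient _) c, fun hε => ⟨(h5 hε).1.const_smul c, ?_⟩⟩
  simpa using (h5 hε).2.smul hD.isDerivation_tangentialGradient c

theorem zero (D : Set (EuclideanSpace ℝ (Fin N))) (hD : IsSmoothBoundedDomain D) :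
    MemVWithGradients D ε 0 0 0 0 := by
  rw [memVWithGradients_iff hD.isOpen]
  have h0 : ContDiff ℝ ∞ (0 : EuclideanSpace ℝ (Fin N) → ℝ) := contDiff_const
  have hg : ∀ {μ : Measure (EuclideanSpace ℝ (Fin N))} {G}, IsDerivation μ G → G 0 = 0 :=
    fun hG => by simpa using hG.map_smul 0 0 h0
  have hl : ∀ {μ ν : Measure (EuclideanSpace ℝ (Fin N))} {G}, IsDerivation μ G →
      IsSmoothLimit μ ν G 0 0 0 := fun hG =>
    ⟨fun _ => 0, fun _ => h0, by simp, by simp [hg hG], by simp⟩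
  exact ⟨MemLp.zero, MemLp.zero, MemLp.zero, hl (isDerivation_gradient _), fun _ =>
    ⟨MemLp.zero, hl hD.isDerivation_tangentialGradient⟩⟩

/-- Composition with a smooth function with bounded derivative that vanishes at the origin. -/
theorem comp (hD : IsSmoothBoundedDomain D) {η : ℝ → ℝ} {C : NNReal} (hη : ContDiff ℝ ∞ η)
    (hC : ∀ s, |deriv η s| ≤ C) (h0 : η 0 = 0) (h : MemVWithGradients D ε u v p w) :
    MemVWithGradients D ε (η ∘ u) (η ∘ v) (fun x => deriv η (u x) • p x)
      (fun x => deriv η (v x) • w x) := by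
  rw [memVWithGradients_iff hD.isOpen] at h ⊢
  obtain ⟨h1, h2, h3, h4, h5⟩ := h
  have hL : LipschitzWith C η := lipschitzWith_of_nnnorm_deriv_le (hη.differentiable (by simp)) hC
  have hmul : ∀ {μ : Measure (EuclideanSpace ℝ (Fin N))} {s : EuclideanSpace ℝ (Fin N) → ℝ}
      {q : EuclideanSpace ℝ (Fin N) → EuclideanSpace ℝ (Fin N)}, AEStronglyMeasurable s μ →
      MemLp q 2 μ → MemLp (fun x => deriv η (s x) • q x) 2 μ := by
    intro μ s q hs hq
    refine hq.of_le_mul (c := C)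
      (((hη.continuous_deriv (by simp)).comp_aestronglyMeasurable hs).smul hq.1)
      (Eventually.of_forall fun x => ?_)
    rw [norm_smul]
    exact mul_le_mul_of_nonneg_right (hC _) (norm_nonneg _)
  -- The normalisation `η 0 = 0` gives `|η(s)| ≤ C|s|`, which keeps the composition in `L²` without
  -- finiteness of the measures.
  refine ⟨hL.comp_memLp h0 h1, hmul h1.1 h2, hL.comp_memLp h0 h3,
    h4.comp (isDerivation_gradient _) hη hC h1.1 h2, fun hε => ⟨hmul h3.1 (h5 hε).1, ?_⟩⟩
  refine ((h5 hε).2.comp hD.isDerivation_tangentialGradient hη hC h3.1 (h5 hε).1).congr_ae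
    EventuallyEq.rfl EventuallyEq.rfl ?_
  rw [EventuallyEq, ae_zero]
  exact eventually_bot

end MemVWithGradients

/-- The Hilbert space `(L²(D) × L²(Γ)) × (L²(D; ℝ^N) × L²(Γ; ℝ^N))`. -/
abbrev EnergySpace (D : Set (EuclideanSpace ℝ (Fin N))) : Type :=
  WithLp 2 (WithLp 2 (Lp ℝ 2 (bulkMeasure D) × Lp ℝ 2 (surfaceMeasure D)) ×
    WithLp 2 (Lp (EuclideanSpace ℝ (Fin N)) 2 (bulkMeasure D) ×
      Lp (EuclideanSpace ℝ (Fin N)) 2 (surfaceMeasure D)))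

/-- The graph of `(u, v) ↦ (∇u, ∇_Γ v)` on `𝒱_ε`, with rescaled gradients. -/
def energySubmodule (hD : IsSmoothBoundedDomain D) (ε α β : ℝ) :
    Submodule ℝ (EnergySpace D) where
  carrier := {X | MemVWithGradients D ε X.fst.fst X.fst.snd (α • X.snd.fst : Lp _ 2 _)
    (β • X.snd.snd : Lp _ 2 _)}
  add_mem' {X Y} hX hY := by
    refine (MemVWithGradients.add hD hX hY).congr_ae hD.isOpen (Lp.coeFn_add _ _).symm
      (Lp.coeFn_add _ _).symm ?_ fun _ => ?_
    · rw [WithLp.add_snd, WithLp.add_fst, smul_add]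
      exact (Lp.coeFn_add _ _).symm
    · rw [WithLp.add_snd, WithLp.add_snd, smul_add]
      exact (Lp.coeFn_add _ _).symm
  zero_mem' := by
    refine (MemVWithGradients.zero D hD).congr_ae hD.isOpen (Lp.coeFn_zero _ _ _).symm
      (Lp.coeFn_zero _ _ _).symm ?_ fun _ => ?_
    · rw [WithLp.zero_snd, WithLp.zero_fst, smul_zero]
      exact (Lp.coeFn_zero _ _ _).symm
    · rw [WithLp.zero_snd, WithLp.zero_snd, smul_zero]
      exact (Lp.coeFn_zero _ _ _).symm
  smul_mem' c X hX := by
    refine (MemVWithGradients.smul hD c hX).congr_ae hD.isOpen (Lp.coeFn_smul _ _).symm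
      (Lp.coeFn_smul _ _).symm ?_ fun _ => ?_
    · rw [WithLp.smul_snd, WithLp.smul_fst, smul_comm]
      exact (Lp.coeFn_smul _ _).symm
    · rw [WithLp.smul_snd, WithLp.smul_snd, smul_comm]
      exact (Lp.coeFn_smul _ _).symm

theorem mem_energySubmodule {hD : IsSmoothBoundedDomain D} {α β : ℝ} {X : EnergySpace D} :
    X ∈ energySubmodule hD ε α β ↔ MemVWithGradients D ε X.fst.fst X.fst.snd
      (α • X.snd.fst : Lp _ 2 _) (β • X.snd.snd : Lp _ 2 _) := Iff.rfl

/-- Convergence in the energy space is `L²` convergence of all four components, and smooth limits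
are closed under it. Closedness gives completeness, hence the orthogonal projection. -/
theorem isClosed_energySubmodule (hD : IsSmoothBoundedDomain D) (ε α β : ℝ) :
    IsClosed (energySubmodule hD ε α β : Set (EnergySpace D)) := by
  refine IsSeqClosed.isClosed fun X Y hX hXY => ?_
  have c1 := (Lp.tendsto_Lp_iff_tendsto_eLpNorm' _ _).1
    ((((WithLp.continuous_fst 2 _ _).comp (WithLp.continuous_fst 2 _ _)).tendsto Y).comp hXY)
  have c2 := (Lp.tendsto_Lp_iff_tendsto_eLpNorm' _ _).1
    ((((WithLp.continuous_snd 2 _ _).comp (WithLp.continuous_fst 2 _ _)).tendsto Y).comp hXY)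
  have c3 := (Lp.tendsto_Lp_iff_tendsto_eLpNorm' _ _).1
    (((((WithLp.continuous_fst 2 _ _).comp (WithLp.continuous_snd 2 _ _)).const_smul α).tendsto
      Y).comp hXY)
  have c4 := (Lp.tendsto_Lp_iff_tendsto_eLpNorm' _ _).1
    (((((WithLp.continuous_snd 2 _ _).comp (WithLp.continuous_snd 2 _ _)).const_smul β).tendsto
      Y).comp hXY)
  have hX' := fun n => (memVWithGradients_iff hD.isOpen).1 (hX n)
  refine (memVWithGradients_iff hD.isOpen).2 ⟨Lp.memLp _, Lp.memLp _, Lp.memLp _, ?_, fun hε =>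
    ⟨Lp.memLp _, ?_⟩⟩
  · exact IsSmoothLimit.of_tendsto (isDerivation_gradient _) (fun n => (Lp.aestronglyMeasurable _))
      (fun n => (Lp.aestronglyMeasurable _)) (fun n => (Lp.aestronglyMeasurable _))
      (Lp.aestronglyMeasurable _) (Lp.aestronglyMeasurable _) (Lp.aestronglyMeasurable _)
      (fun n => (hX' n).2.2.2.1) c1 c3 c2
  · exact IsSmoothLimit.of_tendsto hD.isDerivation_tangentialGradient
      (fun n => (Lp.aestronglyMeasurable _))
      (fun n => (Lp.aestronglyMeasurable _)) (fun n => (aestronglyMeasurable_zero_measure _))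
      (Lp.aestronglyMeasurable _) (Lp.aestronglyMeasurable _) (aestronglyMeasurable_zero_measure _)
      (fun n => ((hX' n).2.2.2.2 hε).2) c2 c4 (by simp)

end WentzellResolvent

/-! ### Existence for the resolvent equation in `L²`, and the test inequality. -/

namespace WentzellResolvent

variable {N : ℕ} {D : Set (EuclideanSpace ℝ (Fin N))} {ε δ : ℝ}

theorem integral_inner_eq_inner_toLp {α H : Type*} [MeasurableSpace α] {μ : Measure α}
    [NormedAddCommGroup H] [InnerProductSpace ℝ H] {f g : α → H} (hf : MemLp f 2 μ)
    (hg : MemLp g 2 μ) :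
    ∫ x, inner ℝ (f x) (g x) ∂μ = inner ℝ (hf.toLp f) (hg.toLp g) := by
  rw [L2.inner_def]
  refine integral_congr_ae ?_
  filter_upwards [hf.coeFn_toLp, hg.coeFn_toLp] with x h1 h2
  rw [h1, h2]

theorem integral_mul_eq_inner_toLp {α : Type*} [MeasurableSpace α] {μ : Measure α}
    {f g : α → ℝ} (hf : MemLp f 2 μ) (hg : MemLp g 2 μ) :
    ∫ x, f x * g x ∂μ = inner ℝ (hf.toLp f) (hg.toLp g) := by
  rw [← integral_inner_eq_inner_toLp hf hg]
  simp only [RCLike.inner_apply, conj_trivial, mul_comm]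

theorem IsResolventL2.congr_ae (hD : IsOpen D) {f f' g g' u u' v v' : EuclideanSpace ℝ (Fin N) → ℝ}
    (h : IsResolventL2 D ε δ f g u v) (hf : f =ᵐ[bulkMeasure D] f')
    (hg : g =ᵐ[surfaceMeasure D] g') (hu : u =ᵐ[bulkMeasure D] u')
    (hv : v =ᵐ[surfaceMeasure D] v') : IsResolventL2 D ε δ f' g' u' v' := by
  obtain ⟨a, b, ⟨ha, hb, p, w, hpw, h⟩, h1, h2⟩ := h
  refine ⟨a, b, ⟨ha, hb, p, w, hpw.congr_ae hD hu hv EventuallyEq.rfl fun _ => EventuallyEq.rfl,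
    h⟩, ?_, ?_⟩
  · filter_upwards [h1, hf, hu] with x k1 k2 k3
    rw [← k2, ← k3, k1]
  · filter_upwards [h2, hg, hv] with x k1 k2 k3
    rw [← k2, ← k3, k1]

/-- The datum `(f, g)` of the resolvent equation as an element of the energy space. -/
noncomputable def energyDatum (F : Lp ℝ 2 (bulkMeasure D) × Lp ℝ 2 (surfaceMeasure D)) : EnergySpace D :=
  WithLp.toLp 2 (WithLp.toLp 2 F, 0)

theorem inner_energyDatum (F : Lp ℝ 2 (bulkMeasure D) × Lp ℝ 2 (surfaceMeasure D))
    (Y : EnergySpace D) :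
    inner ℝ (energyDatum F) Y = inner ℝ F.1 Y.fst.fst + inner ℝ F.2 Y.fst.snd := by
  simp [energyDatum, WithLp.prod_inner_apply]

/-- The graph of `𝒱_ε`, scaled such that the inner product of the energy space is the bilinear
form of `I + δ 𝒞_ε`. -/
noncomputable def resolventSubmodule (hD : IsSmoothBoundedDomain D) (ε δ : ℝ) : Submodule ℝ (EnergySpace D) :=
  energySubmodule hD ε (√δ)⁻¹ (√(δ * ε))⁻¹

instance (hD : IsSmoothBoundedDomain D) (ε δ : ℝ) :
    (resolventSubmodule hD ε δ).HasOrthogonalProjection :=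
  have : CompleteSpace (resolventSubmodule hD ε δ) :=
    (isClosed_energySubmodule hD ε _ _).completeSpace_coe
  inferInstance

/-- The resolvent on `L²(D) × L²(Γ)`, as an orthogonal projection in the energy space. -/
noncomputable def resolventL2 (hD : IsSmoothBoundedDomain D) (ε δ : ℝ)
    (F : Lp ℝ 2 (bulkMeasure D) × Lp ℝ 2 (surfaceMeasure D)) :
    Lp ℝ 2 (bulkMeasure D) × Lp ℝ 2 (surfaceMeasure D) :=
  WithLp.ofLp ((resolventSubmodule hD ε δ).starProjection (energyDatum F)).fst

theorem resolventL2_add (hD : IsSmoothBoundedDomain D)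
    (F G : Lp ℝ 2 (bulkMeasure D) × Lp ℝ 2 (surfaceMeasure D)) :
    resolventL2 hD ε δ (F + G) = resolventL2 hD ε δ F + resolventL2 hD ε δ G := by
  have : energyDatum (F + G) = energyDatum F + energyDatum G := by
    rw [energyDatum, energyDatum, energyDatum, ← WithLp.toLp_add]
    exact congrArg (WithLp.toLp 2) (Prod.ext (WithLp.toLp_add 2 F G) (add_zero 0).symm)
  rw [resolventL2, this, map_add]
  rfl

theorem resolventL2_smul (hD : IsSmoothBoundedDomain D) (c : ℝ)
    (F : Lp ℝ 2 (bulkMeasure D) × Lp ℝ 2 (surfaceMeasure D)) :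
    resolventL2 hD ε δ (c • F) = c • resolventL2 hD ε δ F := by
  have : energyDatum (c • F) = c • energyDatum F := by
    rw [energyDatum, energyDatum, ← WithLp.toLp_smul]
    exact congrArg (WithLp.toLp 2) (Prod.ext (WithLp.toLp_smul 2 c F) (smul_zero c).symm)
  rw [resolventL2, this, map_smul]
  rfl

/-- The projection `X` satisfies `⟨X, Y⟩ = ⟨(F, 0), Y⟩` for every `Y` in the graph. With `a` and `b`
defined as `δ⁻¹` times datum minus solution, this orthogonality is the weak equation multiplied by
`δ`. -/
theorem isResolventL2_resolventL2 (hD : IsSmoothBoundedDomain D) (hε : 0 ≤ ε) (hδ : 0 < δ)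
    (F : Lp ℝ 2 (bulkMeasure D) × Lp ℝ 2 (surfaceMeasure D)) :
    IsResolventL2 D ε δ F.1 F.2 (resolventL2 hD ε δ F).1 (resolventL2 hD ε δ F).2 := by
  set X := (resolventSubmodule hD ε δ).starProjection (energyDatum F) with hX
  have hXm : X ∈ resolventSubmodule hD ε δ := Submodule.starProjection_apply_mem _ _
  have hXo : ∀ Y ∈ resolventSubmodule hD ε δ, inner ℝ X Y = inner ℝ (energyDatum F) Y := by
    intro Y hY
    have := Submodule.starProjection_inner_eq_zero (energyDatum F) Y hY
    rw [inner_sub_left, sub_eq_zero] at this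
    exact this.symm
  have hres : resolventL2 hD ε δ F = (X.fst.fst, X.fst.snd) := rfl
  rw [hres]
  have hsδ : √δ ≠ 0 := (Real.sqrt_pos.2 hδ).ne'
  set a : Lp ℝ 2 (bulkMeasure D) := δ⁻¹ • (F.1 - X.fst.fst) with ha
  set b : Lp ℝ 2 (surfaceMeasure D) := δ⁻¹ • (F.2 - X.fst.snd) with hb
  refine ⟨a, b, ⟨Lp.memLp a, Lp.memLp b, _, _, hXm, ?_⟩, ?_, ?_⟩
  · intro φ ψ q z hφ
    obtain ⟨k1, k2, k3, -, k5⟩ := (memVWithGradients_iff hD.isOpen).1 hφ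
    -- `Z` is the surface component of the test element. For `ε > 0` it is `√(δε) z`; for `ε = 0`
    -- the scaling factor `(√0)⁻¹` is `0` and the component is unconstrained, so `Z = 0` works and
    -- both sides vanish.
    obtain ⟨Z, hZ1, hZ2⟩ : ∃ Z : Lp (EuclideanSpace ℝ (Fin N)) 2 (surfaceMeasure D),
        (0 < ε → ⇑((√(δ * ε))⁻¹ • Z) =ᵐ[surfaceMeasure D] z) ∧
        δ * (ε * ∫ x, inner ℝ (((√(δ * ε))⁻¹ • X.snd.snd : Lp _ 2 _) x) (z x)
          ∂(surfaceMeasure D)) = inner ℝ X.snd.snd Z := by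
      rcases hε.eq_or_lt with h0 | hpos
      · exact ⟨0, fun h => absurd h0 h.ne, by simp [← h0]⟩
      · have hz := (k5 hpos).1
        have hs : √(δ * ε) ≠ 0 := (Real.sqrt_pos.2 (mul_pos hδ hpos)).ne'
        refine ⟨√(δ * ε) • hz.toLp z, fun _ => ?_, ?_⟩
        · rw [inv_smul_smul₀ hs]
          exact hz.coeFn_toLp
        · rw [integral_inner_eq_inner_toLp (Lp.memLp _) hz, Lp.toLp_coeFn, real_inner_smul_left,
            real_inner_smul_right, ← mul_assoc, ← mul_assoc]
          congr 1
          rw [← div_eq_mul_inv, Real.div_sqrt]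
    have hY : (WithLp.toLp 2 (WithLp.toLp 2 (k1.toLp φ, k3.toLp ψ),
        WithLp.toLp 2 (√δ • k2.toLp q, Z)) : EnergySpace D) ∈ resolventSubmodule hD ε δ := by
      refine mem_energySubmodule.2 (hφ.congr_ae hD.isOpen k1.coeFn_toLp.symm k3.coeFn_toLp.symm ?_
        fun h => (hZ1 h).symm)
      simp only [WithLp.toLp_snd, WithLp.toLp_fst, inv_smul_smul₀ hsδ]
      exact k2.coeFn_toLp.symm
    have hi := hXo _ hY
    rw [inner_energyDatum, WithLp.prod_inner_apply, WithLp.prod_inner_apply,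
      WithLp.prod_inner_apply] at hi
    simp only [WithLp.toLp_snd, WithLp.toLp_fst, WithLp.ofLp_fst, WithLp.ofLp_snd] at hi
    rw [← hZ2, real_inner_smul_right] at hi
    rw [integral_mul_eq_inner_toLp (Lp.memLp a) k1, integral_mul_eq_inner_toLp (Lp.memLp b) k3,
      integral_inner_eq_inner_toLp (Lp.memLp _) k2, Lp.toLp_coeFn, Lp.toLp_coeFn, Lp.toLp_coeFn,
      ha, hb, real_inner_smul_left, real_inner_smul_left, real_inner_smul_left, inner_sub_left,
      inner_sub_left]
    have hs2 : √δ = δ * (√δ)⁻¹ := by rw [← div_eq_mul_inv, Real.div_sqrt]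
    rw [hs2] at hi
    generalize ∫ x, inner ℝ (((√(δ * ε))⁻¹ • X.snd.snd : Lp _ 2 _) x) (z x)
      ∂(surfaceMeasure D) = J at hi ⊢
    field_simp
    field_simp at hi
    linarith
  · filter_upwards [Lp.coeFn_smul δ⁻¹ (F.1 - X.fst.fst), Lp.coeFn_sub F.1 X.fst.fst] with x h1 h2
    rw [ha, h1, Pi.smul_apply, h2, Pi.sub_apply, smul_eq_mul, mul_inv_cancel_left₀ hδ.ne']
    ring
  · filter_upwards [Lp.coeFn_smul δ⁻¹ (F.2 - X.fst.snd), Lp.coeFn_sub F.2 X.fst.snd] with x h1 h2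
    rw [hb, h1, Pi.smul_apply, h2, Pi.sub_apply, smul_eq_mul, mul_inv_cancel_left₀ hδ.ne']
    ring

theorem IsResolventL2.memLp (hD : IsOpen D) {f g u v : EuclideanSpace ℝ (Fin N) → ℝ}
    (h : IsResolventL2 D ε δ f g u v) :
    MemLp u 2 (bulkMeasure D) ∧ MemLp v 2 (surfaceMeasure D) := by
  obtain ⟨a, b, ⟨-, -, p, w, hpw, -⟩, -, -⟩ := h
  have := (memVWithGradients_iff hD).1 hpw
  exact ⟨this.1, this.2.2.1⟩

/-- Testing the resolvent equation with `η(u, v)` for a nondecreasing function `η`. -/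
theorem IsResolventL2.integral_mul_comp_nonneg (hD : IsSmoothBoundedDomain D) (hε : 0 ≤ ε)
    (hδ : 0 < δ) {f g u v : EuclideanSpace ℝ (Fin N) → ℝ} (h : IsResolventL2 D ε δ f g u v)
    {η : ℝ → ℝ} {C : NNReal} (hη : ContDiff ℝ ∞ η) (hC : ∀ s, |deriv η s| ≤ C) (h0 : η 0 = 0)
    (hmono : Monotone η) :
    0 ≤ ∫ x, (f x - u x) * η (u x) ∂(bulkMeasure D)
      + ∫ x, (g x - v x) * η (v x) ∂(surfaceMeasure D) := by
  obtain ⟨a, b, ⟨ha, hb, p, w, hpw, h⟩, h1, h2⟩ := h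
  have htest := h _ _ _ _ (hpw.comp hD hη hC h0)
  have e1 : ∫ x, (f x - u x) * η (u x) ∂(bulkMeasure D)
      = δ * ∫ x, a x * (η ∘ u) x ∂(bulkMeasure D) := by
    rw [← integral_const_mul]
    refine integral_congr_ae ?_
    filter_upwards [h1] with x hx
    rw [← hx, Function.comp_apply]
    ring
  have e2 : ∫ x, (g x - v x) * η (v x) ∂(surfaceMeasure D)
      = δ * ∫ x, b x * (η ∘ v) x ∂(surfaceMeasure D) := by
    rw [← integral_const_mul]
    refine integral_congr_ae ?_
    filter_upwards [h2] with x hx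
    rw [← hx, Function.comp_apply]
    ring
  rw [e1, e2, ← mul_add, ← htest]
  have hnn : ∀ (s : ℝ) (y : EuclideanSpace ℝ (Fin N)), 0 ≤ inner ℝ y (deriv η s • y) := by
    intro s y
    rw [real_inner_smul_right]
    exact mul_nonneg hmono.deriv_nonneg real_inner_self_nonneg
  exact mul_nonneg hδ.le (add_nonneg (integral_nonneg fun x => hnn _ _)
    (mul_nonneg hε (integral_nonneg fun x => hnn _ _)))

end WentzellResolvent

/-! ### Uniqueness and the maximum principle in `L²`. -/

namespace WentzellResolvent

variable {N : ℕ} {D : Set (EuclideanSpace ℝ (Fin N))} {ε δ : ℝ}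

/-- Solutions of the resolvent equation are given by the orthogonal projection. -/
theorem IsResolventL2.eq_resolventL2 (hD : IsSmoothBoundedDomain D) (hε : 0 ≤ ε) (hδ : 0 < δ)
    {F U : Lp ℝ 2 (bulkMeasure D) × Lp ℝ 2 (surfaceMeasure D)}
    (h : IsResolventL2 D ε δ F.1 F.2 U.1 U.2) : U = resolventL2 hD ε δ F := by
  obtain ⟨a, b, ⟨ha, hb, p, w, hpw, h⟩, h1, h2⟩ := h
  obtain ⟨-, hp, -, -, hw⟩ := (memVWithGradients_iff hD.isOpen).1 hpw
  have hsδ : √δ ≠ 0 := (Real.sqrt_pos.2 hδ).ne'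
  have hF1 : F.1 - U.1 = δ • ha.toLp a := by
    refine Lp.ext ?_
    filter_upwards [h1, Lp.coeFn_sub F.1 U.1, Lp.coeFn_smul δ (ha.toLp a), ha.coeFn_toLp]
      with x k1 k2 k3 k4
    rw [k2, k3, Pi.sub_apply, Pi.smul_apply, k4, ← k1, smul_eq_mul]
    ring
  have hF2 : F.2 - U.2 = δ • hb.toLp b := by
    refine Lp.ext ?_
    filter_upwards [h2, Lp.coeFn_sub F.2 U.2, Lp.coeFn_smul δ (hb.toLp b), hb.coeFn_toLp]
      with x k1 k2 k3 k4
    rw [k2, k3, Pi.sub_apply, Pi.smul_apply, k4, ← k1, smul_eq_mul]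
    ring
  -- The scaled surface gradient of the given solution, with the same case distinction as for
  -- existence: `√(δε) w` if `ε > 0`, and `0` if `ε = 0`, where `w` carries no information.
  obtain ⟨W, hW1, hW2⟩ : ∃ W : Lp (EuclideanSpace ℝ (Fin N)) 2 (surfaceMeasure D),
      (0 < ε → ⇑((√(δ * ε))⁻¹ • W) =ᵐ[surfaceMeasure D] w) ∧
      ∀ Z : Lp (EuclideanSpace ℝ (Fin N)) 2 (surfaceMeasure D),
        δ * (ε * ∫ x, inner ℝ (w x) (((√(δ * ε))⁻¹ • Z : Lp _ 2 _) x) ∂(surfaceMeasure D))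
          = inner ℝ W Z := by
    rcases hε.eq_or_lt with h0 | hpos
    · exact ⟨0, fun h => absurd h0 h.ne, by simp [← h0]⟩
    · have hz := (hw hpos).1
      have hs : √(δ * ε) ≠ 0 := (Real.sqrt_pos.2 (mul_pos hδ hpos)).ne'
      refine ⟨√(δ * ε) • hz.toLp w, fun _ => ?_, fun Z => ?_⟩
      · rw [inv_smul_smul₀ hs]
        exact hz.coeFn_toLp
      · rw [integral_inner_eq_inner_toLp hz (Lp.memLp _), Lp.toLp_coeFn, real_inner_smul_left,
          real_inner_smul_right, ← mul_assoc, ← mul_assoc]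
        congr 1
        rw [← div_eq_mul_inv, Real.div_sqrt]
  set X : EnergySpace D := WithLp.toLp 2 (WithLp.toLp 2 U, WithLp.toLp 2 (√δ • hp.toLp p, W))
    with hX
  have hXm : X ∈ resolventSubmodule hD ε δ := by
    refine mem_energySubmodule.2 (hpw.congr_ae hD.isOpen EventuallyEq.rfl EventuallyEq.rfl ?_
      fun h => (hW1 h).symm)
    simp only [hX, WithLp.toLp_snd, WithLp.toLp_fst, inv_smul_smul₀ hsδ]
    exact hp.coeFn_toLp.symm
  have hproj : (resolventSubmodule hD ε δ).starProjection (energyDatum F) = X := by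
    refine Submodule.eq_starProjection_of_mem_of_inner_eq_zero hXm fun Y hY => ?_
    have ht := h _ _ _ _ (mem_energySubmodule.1 hY)
    rw [integral_mul_eq_inner_toLp ha (Lp.memLp _), integral_mul_eq_inner_toLp hb (Lp.memLp _),
      integral_inner_eq_inner_toLp hp (Lp.memLp _), Lp.toLp_coeFn, Lp.toLp_coeFn, Lp.toLp_coeFn,
      real_inner_smul_right] at ht
    have hXY : inner ℝ X Y = inner ℝ U.1 Y.fst.fst + inner ℝ U.2 Y.fst.snd
        + (√δ * inner ℝ (hp.toLp p) Y.snd.fst + inner ℝ W Y.snd.snd) := by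
      rw [← real_inner_smul_left]
      rfl
    have e1 := congrArg (fun V => inner ℝ V Y.fst.fst) hF1
    have e2 := congrArg (fun V => inner ℝ V Y.fst.snd) hF2
    simp only [inner_sub_left, real_inner_smul_left] at e1 e2
    rw [inner_sub_left, inner_energyDatum, hXY, ← hW2]
    have ht' := congrArg (fun t => δ * t) ht
    simp only [mul_add] at ht'
    have e3 : δ * ((√δ)⁻¹ * inner ℝ (hp.toLp p) Y.snd.fst)
        = √δ * inner ℝ (hp.toLp p) Y.snd.fst := by
      rw [← mul_assoc, ← div_eq_mul_inv, Real.div_sqrt]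
    rw [e3] at ht'
    linarith
  rw [resolventL2, hproj]
  rfl

/-- Uniqueness for the resolvent equation in `L²(D) × L²(Γ)`. -/
theorem IsResolventL2.ae_unique (hD : IsSmoothBoundedDomain D) (hε : 0 ≤ ε) (hδ : 0 < δ)
    {f g u v u' v' : EuclideanSpace ℝ (Fin N) → ℝ} (hf : MemLp f 2 (bulkMeasure D))
    (hg : MemLp g 2 (surfaceMeasure D)) (h : IsResolventL2 D ε δ f g u v)
    (h' : IsResolventL2 D ε δ f g u' v') :
    u =ᵐ[bulkMeasure D] u' ∧ v =ᵐ[surfaceMeasure D] v' := by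
  have key : ∀ {s t : EuclideanSpace ℝ (Fin N) → ℝ} (hs : MemLp s 2 (bulkMeasure D))
      (ht : MemLp t 2 (surfaceMeasure D)), IsResolventL2 D ε δ f g s t →
      (hs.toLp s, ht.toLp t) = resolventL2 hD ε δ (hf.toLp f, hg.toLp g) := fun hs ht hst =>
    (hst.congr_ae hD.isOpen hf.coeFn_toLp.symm hg.coeFn_toLp.symm hs.coeFn_toLp.symm
      ht.coeFn_toLp.symm).eq_resolventL2 hD hε hδ
  have hm := h.memLp hD.isOpen
  have hm' := h'.memLp hD.isOpen
  have heq := (key hm.1 hm.2 h).trans (key hm'.1 hm'.2 h').symm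
  exact ⟨(MemLp.toLp_eq_toLp_iff hm.1 hm'.1).1 (congrArg Prod.fst heq),
    (MemLp.toLp_eq_toLp_iff hm.2 hm'.2).1 (congrArg Prod.snd heq)⟩

theorem ae_eq_zero_of_integral_eq_zero_of_nonpos {α : Type*} [MeasurableSpace α] {μ : Measure α}
    {f : α → ℝ} (hf : f ≤ᵐ[μ] 0) (hi : Integrable f μ) (h : ∫ x, f x ∂μ = 0) : f =ᵐ[μ] 0 := by
  have h' : -f =ᵐ[μ] 0 := by
    refine (integral_eq_zero_iff_of_nonneg_ae ?_ hi.neg).1 ?_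
    · filter_upwards [hf] with x hx using neg_nonneg.2 hx
    · simp only [Pi.neg_apply, integral_neg, h, neg_zero]
  simpa using h'.neg

/-- The maximum principle in `L²(D) × L²(Γ)`. -/
theorem IsResolventL2.ae_le (hD : IsSmoothBoundedDomain D) (hε : 0 ≤ ε) (hδ : 0 < δ)
    {f g u v : EuclideanSpace ℝ (Fin N) → ℝ} (h : IsResolventL2 D ε δ f g u v) {M : ℝ}
    (hM : 0 < M) (hf2 : MemLp f 2 (bulkMeasure D)) (hg2 : MemLp g 2 (surfaceMeasure D))
    (hf : ∀ᵐ x ∂(bulkMeasure D), f x ≤ M) (hg : ∀ᵐ x ∂(surfaceMeasure D), g x ≤ M) :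
    (∀ᵐ x ∂(bulkMeasure D), u x ≤ M) ∧ ∀ᵐ x ∂(surfaceMeasure D), v x ≤ M := by
  -- A smooth substitute for the positive part of `s - M`: zero up to `M`, positive beyond. Its
  -- derivative lives on `[M, M + 1]` and is therefore bounded; `M > 0` ensures `η 0 = 0`.
  set η : ℝ → ℝ := fun s => Real.smoothTransition (s - M) with hη
  have hsm : ContDiff ℝ ∞ η := Real.smoothTransition.contDiff.comp (contDiff_id.sub contDiff_const)
  have hmono : Monotone η := fun s t hst => Real.smoothTransition.monotone (by linarith)
  have h0 : η 0 = 0 := Real.smoothTransition.zero_of_nonpos (by linarith)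
  obtain ⟨C, hC⟩ : ∃ C, ∀ s, ‖deriv η s‖ ≤ C := by
    refine (hsm.continuous_deriv (by simp)).bounded_above_of_compact_support
      (HasCompactSupport.intro (isCompact_Icc (a := M) (b := M + 1)) fun s hs => ?_)
    rw [mem_Icc, not_and_or, not_le, not_le] at hs
    rcases hs with hs | hs
    · have : η =ᶠ[𝓝 s] fun _ => 0 := by
        filter_upwards [Iio_mem_nhds hs] with t ht
        exact Real.smoothTransition.zero_of_nonpos (sub_nonpos.2 (le_of_lt ht))
      rw [this.deriv_eq, deriv_const]
    · have : η =ᶠ[𝓝 s] fun _ => 1 := by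
        filter_upwards [Ioi_mem_nhds hs] with t ht
        exact Real.smoothTransition.one_of_one_le (by linarith [mem_Ioi.1 ht])
      rw [this.deriv_eq, deriv_const]
  have hC0 : 0 ≤ C := (norm_nonneg _).trans (hC 0)
  have hC' : ∀ s, |deriv η s| ≤ (⟨C, hC0⟩ : NNReal) := hC
  have hL : LipschitzWith ⟨C, hC0⟩ η :=
    lipschitzWith_of_nnnorm_deriv_le (hsm.differentiable (by simp)) hC'
  have hkey := h.integral_mul_comp_nonneg hD hε hδ hsm hC' h0 hmono
  obtain ⟨hu, hv⟩ := h.memLp hD.isOpen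
  have hsign : ∀ {r s : ℝ}, r ≤ M → (r - s) * η s ≤ 0 := by
    intro r s hr
    rcases le_or_gt s M with hs | hs
    · rw [hη]
      simp only
      rw [Real.smoothTransition.zero_of_nonpos (sub_nonpos.2 hs), mul_zero]
    · exact mul_nonpos_of_nonpos_of_nonneg (by linarith) (Real.smoothTransition.nonneg _)
  have hzero : ∀ {r s : ℝ}, r ≤ M → (r - s) * η s = 0 → s ≤ M := by
    intro r s hr hrs
    by_contra! hs
    exact (mul_neg_of_neg_of_pos (by linarith : r - s < 0)
      (Real.smoothTransition.pos_of_pos (sub_pos.2 hs))).ne hrs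
  have i1 : Integrable (fun x => (f x - u x) * η (u x)) (bulkMeasure D) :=
    (hf2.sub hu).integrable_mul (hL.comp_memLp h0 hu)
  have i2 : Integrable (fun x => (g x - v x) * η (v x)) (surfaceMeasure D) :=
    (hg2.sub hv).integrable_mul (hL.comp_memLp h0 hv)
  have n1 : (fun x => (f x - u x) * η (u x)) ≤ᵐ[bulkMeasure D] 0 := hf.mono fun x hx => hsign hx
  have n2 : (fun x => (g x - v x) * η (v x)) ≤ᵐ[surfaceMeasure D] 0 :=
    hg.mono fun x hx => hsign hx
  have l1 := integral_nonpos_of_ae n1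
  have l2 := integral_nonpos_of_ae n2
  -- Two nonpositive integrals with nonnegative sum are both zero.
  have z1 := ae_eq_zero_of_integral_eq_zero_of_nonpos n1 i1 (by linarith)
  have z2 := ae_eq_zero_of_integral_eq_zero_of_nonpos n2 i2 (by linarith)
  constructor
  · filter_upwards [hf, z1] with x k1 k2 using hzero k1 k2
  · filter_upwards [hg, z2] with x k1 k2 using hzero k1 k2

end WentzellResolvent

/-! ### The `L¹` bound for the resolvent. -/

namespace WentzellResolvent

variable {N : ℕ} {D : Set (EuclideanSpace ℝ (Fin N))} {ε δ : ℝ}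

theorem mul_arctan_nonneg (k s : ℝ) (hk : 0 ≤ k) : 0 ≤ s * Real.arctan (k * s) := by
  rcases le_total 0 s with hs | hs
  · exact mul_nonneg hs (Real.arctan_nonneg.2 (mul_nonneg hk hs))
  · exact mul_nonneg_of_nonpos_of_nonpos hs
      (Real.arctan_le_zero.2 (mul_nonpos_of_nonneg_of_nonpos hk hs))

theorem abs_arctan_le (s : ℝ) : |Real.arctan s| ≤ Real.pi / 2 :=
  abs_le.2 ⟨(Real.neg_pi_div_two_lt_arctan s).le, (Real.arctan_lt_pi_div_two s).le⟩

theorem tendsto_mul_arctan (s : ℝ) :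
    Tendsto (fun k : ℕ => s * Real.arctan (k * s)) atTop (𝓝 (Real.pi / 2 * |s|)) := by
  rcases lt_trichotomy s 0 with hs | rfl | hs
  · have h : Tendsto (fun k : ℕ => (k : ℝ) * s) atTop atBot :=
      tendsto_natCast_atTop_atTop.atTop_mul_const_of_neg hs
    have := ((Real.tendsto_arctan_atBot.mono_right nhdsWithin_le_nhds).comp h).const_mul s
    rwa [show s * -(Real.pi / 2) = Real.pi / 2 * |s| by rw [abs_of_neg hs]; ring] at this
  · simp
  · have h : Tendsto (fun k : ℕ => (k : ℝ) * s) atTop atTop :=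
      tendsto_natCast_atTop_atTop.atTop_mul_const hs
    have := ((Real.tendsto_arctan_atTop.mono_right nhdsWithin_le_nhds).comp h).const_mul s
    rwa [show s * (Real.pi / 2) = Real.pi / 2 * |s| by rw [abs_of_pos hs]; ring] at this

/-- If the regularizations `u arctan(k u)` of `π/2 |u|` have bounded integrals then `u ∈ L¹`. -/
theorem eLpNorm_one_le_of_integral_mul_arctan_le {α : Type*} [MeasurableSpace α] {μ : Measure α}
    {u : α → ℝ} {K : ℝ}
    (hi : ∀ k : ℕ, Integrable (fun x => u x * Real.arctan (k * u x)) μ)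
    (h : ∀ k : ℕ, ∫ x, u x * Real.arctan (k * u x) ∂μ ≤ Real.pi / 2 * K) :
    eLpNorm u 1 μ ≤ ENNReal.ofReal K := by
  have hpi : 0 < Real.pi / 2 := by positivity
  have hnn : ∀ (k : ℕ) x, 0 ≤ u x * Real.arctan (k * u x) := fun k x =>
    mul_arctan_nonneg _ _ k.cast_nonneg
  have hbound : ∀ k : ℕ, ∫⁻ x, ENNReal.ofReal (u x * Real.arctan (k * u x)) ∂μ
      ≤ ENNReal.ofReal (Real.pi / 2 * K) := fun k => by
    rw [← ofReal_integral_eq_lintegral_ofReal (hi k) (Eventually.of_forall (hnn k))]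
    exact ENNReal.ofReal_le_ofReal (h k)
  have hfatou : ∫⁻ x, ENNReal.ofReal (Real.pi / 2 * |u x|) ∂μ
      ≤ ENNReal.ofReal (Real.pi / 2 * K) := by
    calc ∫⁻ x, ENNReal.ofReal (Real.pi / 2 * |u x|) ∂μ
        = ∫⁻ x, liminf (fun k : ℕ => ENNReal.ofReal (u x * Real.arctan (k * u x))) atTop ∂μ :=
          lintegral_congr fun x =>
            (ENNReal.tendsto_ofReal (tendsto_mul_arctan (u x))).liminf_eq.symm
      _ ≤ liminf (fun k : ℕ => ∫⁻ x, ENNReal.ofReal (u x * Real.arctan (k * u x)) ∂μ) atTop :=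
          lintegral_liminf_le' fun k => (hi k).1.aemeasurable.ennreal_ofReal
      _ ≤ ENNReal.ofReal (Real.pi / 2 * K) :=
          -- Any eventual lower bound lies below some term of the sequence, and every term obeys the
          -- assumed bound.
          liminf_le_of_le (by isBoundedDefault) fun b hb => by
            obtain ⟨k, hk⟩ := hb.exists
            exact hk.trans (hbound k)
  simp only [ENNReal.ofReal_mul hpi.le] at hfatou
  rw [lintegral_const_mul' _ _ ENNReal.ofReal_ne_top,
    ENNReal.mul_le_mul_iff_right (by simpa using hpi) ENNReal.ofReal_ne_top] at hfatou
  rw [eLpNorm_one_eq_lintegral_enorm]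
  simpa only [Real.enorm_eq_ofReal_abs] using hfatou

/-- The resolvent is a contraction for the norm of `L¹(D) × L¹(Γ)`. -/
theorem IsResolventL2.eLpNorm_one_le (hD : IsSmoothBoundedDomain D) (hε : 0 ≤ ε) (hδ : 0 < δ)
    {f g u v : EuclideanSpace ℝ (Fin N) → ℝ} (h : IsResolventL2 D ε δ f g u v)
    (hf2 : MemLp f 2 (bulkMeasure D)) (hg2 : MemLp g 2 (surfaceMeasure D))
    (hf : Integrable f (bulkMeasure D)) (hg : Integrable g (surfaceMeasure D)) :
    eLpNorm u 1 (bulkMeasure D) ≤ ENNReal.ofReal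
      (∫ x, ‖f x‖ ∂(bulkMeasure D) + ∫ x, ‖g x‖ ∂(surfaceMeasure D)) ∧
    eLpNorm v 1 (surfaceMeasure D) ≤ ENNReal.ofReal
      (∫ x, ‖f x‖ ∂(bulkMeasure D) + ∫ x, ‖g x‖ ∂(surfaceMeasure D)) := by
  obtain ⟨hu, hv⟩ := h.memLp hD.isOpen
  have hsm : ∀ k : ℕ, ContDiff ℝ ∞ fun s : ℝ => Real.arctan (k * s) := fun k =>
    Real.contDiff_arctan.comp (contDiff_const.mul contDiff_id)
  have hder : ∀ (k : ℕ) (s : ℝ), |deriv (fun s : ℝ => Real.arctan (k * s)) s|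
      ≤ ((k : NNReal) : ℝ) := by
    intro k s
    have hd : HasDerivAt (fun s : ℝ => Real.arctan (k * s)) (1 / (1 + (k * s) ^ 2) * (k * 1)) s :=
      ((hasDerivAt_id s).const_mul (k : ℝ)).arctan
    rw [hd.deriv, mul_one, abs_of_nonneg (by positivity), NNReal.coe_natCast]
    exact mul_le_of_le_one_left k.cast_nonneg
      ((div_le_one (by positivity)).2 (by nlinarith [sq_nonneg (k * s)]))
  have h0 : ∀ k : ℕ, (fun s : ℝ => Real.arctan (k * s)) 0 = 0 := fun k => by simp
  have hmono : ∀ k : ℕ, Monotone fun s : ℝ => Real.arctan (k * s) := fun k s t hst =>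
    Real.arctan_strictMono.monotone (mul_le_mul_of_nonneg_left hst k.cast_nonneg)
  have hL : ∀ k : ℕ, LipschitzWith (k : NNReal) fun s : ℝ => Real.arctan (k * s) := fun k =>
    lipschitzWith_of_nnnorm_deriv_le ((hsm k).differentiable (by simp)) (hder k)
  have split : ∀ {μ : Measure (EuclideanSpace ℝ (Fin N))} {s t : EuclideanSpace ℝ (Fin N) → ℝ},
      MemLp s 2 μ → MemLp t 2 μ → Integrable s μ → ∀ k : ℕ,
      Integrable (fun x => t x * Real.arctan (k * t x)) μ ∧
      ∫ x, (s x - t x) * Real.arctan (k * t x) ∂μ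
        ≤ Real.pi / 2 * ∫ x, ‖s x‖ ∂μ - ∫ x, t x * Real.arctan (k * t x) ∂μ := by
    intro μ s t hs ht hs1 k
    have hη : MemLp (fun x => Real.arctan (k * t x)) 2 μ := (hL k).comp_memLp (h0 k) ht
    have i1 : Integrable (fun x => s x * Real.arctan (k * t x)) μ := hs.integrable_mul hη
    have i2 : Integrable (fun x => t x * Real.arctan (k * t x)) μ := ht.integrable_mul hη
    refine ⟨i2, ?_⟩
    simp only [sub_mul]
    rw [integral_sub i1 i2, ← integral_const_mul]
    refine sub_le_sub_right (integral_mono i1 (hs1.norm.const_mul _) fun x => ?_) _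
    refine (le_abs_self _).trans ?_
    rw [abs_mul, mul_comm, ← Real.norm_eq_abs (s x)]
    exact mul_le_mul_of_nonneg_right (abs_arctan_le _) (norm_nonneg _)
  have htest := fun k : ℕ =>
    h.integral_mul_comp_nonneg hD hε hδ (hsm k) (hder k) (h0 k) (hmono k)
  have hnn : ∀ (μ : Measure (EuclideanSpace ℝ (Fin N))) (t : EuclideanSpace ℝ (Fin N) → ℝ)
      (k : ℕ), 0 ≤ ∫ x, t x * Real.arctan (k * t x) ∂μ := fun μ t k =>
    integral_nonneg fun x => mul_arctan_nonneg _ _ k.cast_nonneg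
  constructor
  · refine eLpNorm_one_le_of_integral_mul_arctan_le (fun k => (split hf2 hu hf k).1)
      fun k => ?_
    -- The test inequality bounds the sum of the bulk and surface integrals; the surface one is
    -- nonnegative and can be dropped.
    linarith [htest k, (split hf2 hu hf k).2, (split hg2 hv hg k).2, hnn (surfaceMeasure D) v k]
  · refine eLpNorm_one_le_of_integral_mul_arctan_le (fun k => (split hg2 hv hg k).1)
      fun k => ?_
    linarith [htest k, (split hf2 hu hf k).2, (split hg2 hv hg k).2, hnn (bulkMeasure D) u k]

end WentzellResolvent

/-! ### Extension to `L¹` and the maximum principle there. -/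

namespace WentzellResolvent

variable {N : ℕ} {D : Set (EuclideanSpace ℝ (Fin N))} {ε δ : ℝ}

/-- The elements of `L¹(D) × L¹(Γ)` that belong to `L²(D) × L²(Γ)`. -/
def squareIntegrable (D : Set (EuclideanSpace ℝ (Fin N))) : Submodule ℝ (L1Space D) where
  carrier := {F | MemLp F.1 2 (bulkMeasure D) ∧ MemLp F.2 2 (surfaceMeasure D)}
  add_mem' {F G} hF hG := ⟨(hF.1.add hG.1).ae_eq (Lp.coeFn_add F.1 G.1).symm,
    (hF.2.add hG.2).ae_eq (Lp.coeFn_add F.2 G.2).symm⟩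
  zero_mem' := ⟨MemLp.zero.ae_eq (Lp.coeFn_zero _ _ _).symm,
    MemLp.zero.ae_eq (Lp.coeFn_zero _ _ _).symm⟩
  smul_mem' c F hF := ⟨(hF.1.const_smul c).ae_eq (Lp.coeFn_smul c F.1).symm,
    (hF.2.const_smul c).ae_eq (Lp.coeFn_smul c F.2).symm⟩

/-- Simple functions are dense in `L¹`, and an integrable simple function has support of finite
measure, so it lies in every `Lᵖ`; finiteness of `μ` is not needed. -/
theorem dense_setOf_memLp_two {α : Type*} [MeasurableSpace α] (μ : Measure α) :
    Dense {f : Lp ℝ 1 μ | MemLp f 2 μ} := by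
  refine (Lp.simpleFunc.dense (E := ℝ) (p := 1) (μ := μ) ENNReal.one_ne_top).mono fun f hf => ?_
  have h1 := Lp.simpleFunc.memLp ⟨f, hf⟩
  have h2 : MemLp (Lp.simpleFunc.toSimpleFunc ⟨f, hf⟩) 2 μ :=
    (SimpleFunc.memLp_iff two_ne_zero ENNReal.ofNat_ne_top).2
      ((SimpleFunc.memLp_iff one_ne_zero ENNReal.one_ne_top).1 h1)
  exact h2.ae_eq (Lp.simpleFunc.toSimpleFunc_eq_toFun ⟨f, hf⟩)

theorem dense_squareIntegrable (D : Set (EuclideanSpace ℝ (Fin N))) :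
    Dense (squareIntegrable D : Set (L1Space D)) :=
  (dense_setOf_memLp_two (bulkMeasure D)).prod (dense_setOf_memLp_two (surfaceMeasure D))

/-- The element of `L²(D) × L²(Γ)` given by a square integrable element of `L¹(D) × L¹(Γ)`. -/
noncomputable def toL2 (F : squareIntegrable D) :
    Lp ℝ 2 (bulkMeasure D) × Lp ℝ 2 (surfaceMeasure D) :=
  (F.2.1.toLp _, F.2.2.toLp _)

theorem toL2_add (F G : squareIntegrable D) :
    toL2 (F + G) = toL2 F + toL2 G :=
  Prod.ext
    ((MemLp.toLp_congr (F + G).2.1 _ (Lp.coeFn_add F.1.1 G.1.1)).trans (MemLp.toLp_add F.2.1 G.2.1))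
    ((MemLp.toLp_congr (F + G).2.2 _ (Lp.coeFn_add F.1.2 G.1.2)).trans (MemLp.toLp_add F.2.2 G.2.2))

theorem toL2_smul (c : ℝ) (F : squareIntegrable D) :
    toL2 (c • F) = c • toL2 F :=
  Prod.ext
    ((MemLp.toLp_congr (c • F).2.1 _ (Lp.coeFn_smul c F.1.1)).trans (MemLp.toLp_const_smul c F.2.1))
    ((MemLp.toLp_congr (c • F).2.2 _ (Lp.coeFn_smul c F.1.2)).trans (MemLp.toLp_const_smul c F.2.2))

theorem isResolventL2_toL2 (hD : IsSmoothBoundedDomain D) (hε : 0 ≤ ε) (hδ : 0 < δ)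
    (F : squareIntegrable D) :
    IsResolventL2 D ε δ F.1.1 F.1.2 (resolventL2 hD ε δ (toL2 F)).1
      (resolventL2 hD ε δ (toL2 F)).2 :=
  (isResolventL2_resolventL2 hD hε hδ (toL2 F)).congr_ae hD.isOpen F.2.1.coeFn_toLp
    F.2.2.coeFn_toLp EventuallyEq.rfl EventuallyEq.rfl

theorem eLpNorm_resolventL2_toL2_le (hD : IsSmoothBoundedDomain D) (hε : 0 ≤ ε) (hδ : 0 < δ)
    (F : squareIntegrable D) :
    eLpNorm (resolventL2 hD ε δ (toL2 F)).1 1 (bulkMeasure D) ≤ ENNReal.ofReal (2 * ‖F‖) ∧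
    eLpNorm (resolventL2 hD ε δ (toL2 F)).2 1 (surfaceMeasure D) ≤ ENNReal.ofReal (2 * ‖F‖) := by
  have h := (isResolventL2_toL2 hD hε hδ F).eLpNorm_one_le hD hε hδ F.2.1 F.2.2
    (L1.integrable_coeFn _) (L1.integrable_coeFn _)
  rw [← L1.norm_eq_integral_norm, ← L1.norm_eq_integral_norm] at h
  -- The product carries the maximum norm, which is the source of the factor `2`.
  have hle : ‖F.1.1‖ + ‖F.1.2‖ ≤ 2 * ‖F‖ := by
    rw [two_mul]
    exact add_le_add (norm_fst_le F.1) (norm_snd_le F.1)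
  exact ⟨h.1.trans (ENNReal.ofReal_le_ofReal hle), h.2.trans (ENNReal.ofReal_le_ofReal hle)⟩

theorem memLp_one_resolventL2_toL2 (hD : IsSmoothBoundedDomain D) (hε : 0 ≤ ε) (hδ : 0 < δ)
    (F : squareIntegrable D) :
    MemLp (resolventL2 hD ε δ (toL2 F)).1 1 (bulkMeasure D) ∧
    MemLp (resolventL2 hD ε δ (toL2 F)).2 1 (surfaceMeasure D) :=
  have h := eLpNorm_resolventL2_toL2_le hD hε hδ F
  ⟨⟨Lp.aestronglyMeasurable _, h.1.trans_lt ENNReal.ofReal_lt_top⟩,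
    ⟨Lp.aestronglyMeasurable _, h.2.trans_lt ENNReal.ofReal_lt_top⟩⟩

/-- The resolvent on the square integrable elements of `L¹(D) × L¹(Γ)`. -/
noncomputable def resolventDense (hD : IsSmoothBoundedDomain D) (hε : 0 ≤ ε) (hδ : 0 < δ) :
    squareIntegrable D →L[ℝ] L1Space D :=
  have m := memLp_one_resolventL2_toL2 hD hε hδ
  LinearMap.mkContinuous
    { toFun := fun F => ((m F).1.toLp _, (m F).2.toLp _)
      map_add' := fun F G => by
        have h : resolventL2 hD ε δ (toL2 (F + G))
            = resolventL2 hD ε δ (toL2 F) + resolventL2 hD ε δ (toL2 G) := by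
          rw [toL2_add, resolventL2_add]
        refine Prod.ext ?_ ?_
        · refine (MemLp.toLp_congr (m (F + G)).1 ((m F).1.add (m G).1) ?_).trans
            (MemLp.toLp_add (m F).1 (m G).1)
          rw [h]
          exact Lp.coeFn_add _ _
        · refine (MemLp.toLp_congr (m (F + G)).2 ((m F).2.add (m G).2) ?_).trans
            (MemLp.toLp_add (m F).2 (m G).2)
          rw [h]
          exact Lp.coeFn_add _ _
      map_smul' := fun c F => by
        have h : resolventL2 hD ε δ (toL2 (c • F)) = c • resolventL2 hD ε δ (toL2 F) := by
          rw [toL2_smul, resolventL2_smul]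
        refine Prod.ext ?_ ?_
        · refine (MemLp.toLp_congr (m (c • F)).1 ((m F).1.const_smul c) ?_).trans
            (MemLp.toLp_const_smul c (m F).1)
          rw [h]
          exact Lp.coeFn_smul _ _
        · refine (MemLp.toLp_congr (m (c • F)).2 ((m F).2.const_smul c) ?_).trans
            (MemLp.toLp_const_smul c (m F).2)
          rw [h]
          exact Lp.coeFn_smul _ _ }
    2 fun F => by
      have h := eLpNorm_resolventL2_toL2_le hD hε hδ F
      refine norm_prod_le_iff.2 ⟨?_, ?_⟩
      · exact (Lp.norm_toLp _ (m F).1).trans_le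
          (ENNReal.toReal_le_of_le_ofReal (by positivity) h.1)
      · exact (Lp.norm_toLp _ (m F).2).trans_le
          (ENNReal.toReal_le_of_le_ofReal (by positivity) h.2)

theorem isResolventL2_resolventDense (hD : IsSmoothBoundedDomain D) (hε : 0 ≤ ε) (hδ : 0 < δ)
    (F : squareIntegrable D) :
    IsResolventL2 D ε δ F.1.1 F.1.2 (resolventDense hD hε hδ F).1
      (resolventDense hD hε hδ F).2 :=
  (isResolventL2_toL2 hD hε hδ F).congr_ae hD.isOpen EventuallyEq.rfl EventuallyEq.rfl
    (MemLp.coeFn_toLp (memLp_one_resolventL2_toL2 hD hε hδ F).1).symm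
    (MemLp.coeFn_toLp (memLp_one_resolventL2_toL2 hD hε hδ F).2).symm

/-- The `L¹` bound makes the resolvent on square integrable pairs continuous for the `L¹` norm, so
it extends from this dense subspace. -/
theorem exists_isResolventL1 (hD : IsSmoothBoundedDomain D) (hε : 0 ≤ ε) (hδ : 0 < δ) :
    ∃ R : L1Space D →L[ℝ] L1Space D, IsResolventL1 D ε δ R := by
  refine ⟨(resolventDense hD hε hδ).extend (squareIntegrable D).subtypeL, fun F h1 h2 => ?_⟩
  have hext := ContinuousLinearMap.extend_eq (resolventDense hD hε hδ)
    (e := (squareIntegrable D).subtypeL) (dense_squareIntegrable D).denseRange_val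
    (isUniformInducing_val _) ⟨F, h1, h2⟩
  have h := isResolventL2_resolventDense hD hε hδ ⟨F, h1, h2⟩
  rw [← hext] at h
  exact h

theorem IsResolventL1.unique (hD : IsSmoothBoundedDomain D) (hε : 0 ≤ ε) (hδ : 0 < δ)
    {R S : L1Space D →L[ℝ] L1Space D} (hR : IsResolventL1 D ε δ R)
    (hS : IsResolventL1 D ε δ S) : R = S := by
  refine ContinuousLinearMap.ext fun F => congrFun
    (R.continuous.ext_on (dense_squareIntegrable D) S.continuous fun G hG => ?_) F
  have h := (hR G hG.1 hG.2).ae_unique hD hε hδ hG.1 hG.2 (hS G hG.1 hG.2)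
  exact Prod.ext (Lp.ext h.1) (Lp.ext h.2)

section Truncation

variable {α : Type*} [MeasurableSpace α] {μ : Measure α}

theorem lipschitzWith_min_const (M : ℝ) : LipschitzWith 1 fun s : ℝ => min s M :=
  LipschitzWith.id.min_const M

/-- An upper bound becomes a fixed point equation for a continuous map on `L¹`, which is how such
bounds are shown to be closed under limits. The condition `min 0 M = 0` makes truncation act on `Lᵖ`
without finiteness of the measure. -/
theorem compLp_min_eq_self_iff {M : ℝ} (hM : min 0 M = 0) (f : Lp ℝ 1 μ) :
    (lipschitzWith_min_const M).compLp hM f = f ↔ ∀ᵐ x ∂μ, f x ≤ M := by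
  have h := (lipschitzWith_min_const M).coeFn_compLp hM f
  rw [Lp.ext_iff]
  constructor
  · intro h'
    filter_upwards [h, h'] with x h1 h2
    rw [h2] at h1
    exact min_eq_left_iff.1 h1.symm
  · intro h'
    filter_upwards [h, h'] with x h1 h2
    rw [h1]
    exact min_eq_left h2

theorem compLp_min_ae_le {M : ℝ} (hM : min 0 M = 0) (f : Lp ℝ 1 μ) :
    ∀ᵐ x ∂μ, (lipschitzWith_min_const M).compLp hM f x ≤ M := by
  filter_upwards [(lipschitzWith_min_const M).coeFn_compLp hM f] with x hx
  rw [hx]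
  exact min_le_right _ _

theorem isClosed_setOf_ae_le {M : ℝ} (hM : min 0 M = 0) :
    IsClosed {f : Lp ℝ 1 μ | ∀ᵐ x ∂μ, f x ≤ M} := by
  simp only [← compLp_min_eq_self_iff hM]
  exact isClosed_eq ((lipschitzWith_min_const M).continuous_compLp hM) continuous_id

end Truncation

/-- The maximum principle in `L¹(D) × L¹(Γ)`. -/
theorem IsResolventL1.ae_le (hD : IsSmoothBoundedDomain D) (hε : 0 ≤ ε) (hδ : 0 < δ)
    {R : L1Space D →L[ℝ] L1Space D} (hR : IsResolventL1 D ε δ R) {M : ℝ} (hM : 0 < M)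
    {F : L1Space D} (hf : ∀ᵐ x ∂(bulkMeasure D), F.1 x ≤ M)
    (hg : ∀ᵐ x ∂(surfaceMeasure D), F.2 x ≤ M) :
    (∀ᵐ x ∂(bulkMeasure D), (R F).1 x ≤ M) ∧ ∀ᵐ x ∂(surfaceMeasure D), (R F).2 x ≤ M := by
  have h0 : min 0 M = 0 := min_eq_left hM.le
  set T : L1Space D → L1Space D := Prod.map ((lipschitzWith_min_const M).compLp h0)
    ((lipschitzWith_min_const M).compLp h0) with hT
  have hTc : Continuous T := ((lipschitzWith_min_const M).continuous_compLp h0).prodMap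
    ((lipschitzWith_min_const M).continuous_compLp h0)
  have hTF : T F = F :=
    Prod.ext ((compLp_min_eq_self_iff h0 F.1).2 hf) ((compLp_min_eq_self_iff h0 F.2).2 hg)
  -- The truncated datum `T G` satisfies the upper bound for every `G`, so the conclusion for `R (T
  -- G)` can be proved on the dense set of square integrable `G` and extended by closedness; at `G =
  -- F` truncation does nothing.
  have hcl : IsClosed {G : L1Space D | (∀ᵐ x ∂(bulkMeasure D), (R (T G)).1 x ≤ M) ∧
      ∀ᵐ x ∂(surfaceMeasure D), (R (T G)).2 x ≤ M} :=
    ((isClosed_setOf_ae_le h0).preimage (continuous_fst.comp (R.continuous.comp hTc))).inter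
      ((isClosed_setOf_ae_le h0).preimage (continuous_snd.comp (R.continuous.comp hTc)))
  have hall := hcl.closure_subset_iff.2 (fun G (hG : G ∈ squareIntegrable D) => by
    have m1 : MemLp (T G).1 2 (bulkMeasure D) :=
      ((lipschitzWith_min_const M).comp_memLp h0 hG.1).ae_eq
        ((lipschitzWith_min_const M).coeFn_compLp h0 G.1).symm
    have m2 : MemLp (T G).2 2 (surfaceMeasure D) :=
      ((lipschitzWith_min_const M).comp_memLp h0 hG.2).ae_eq
        ((lipschitzWith_min_const M).coeFn_compLp h0 G.2).symm
    exact (hR (T G) m1 m2).ae_le hD hε hδ hM m1 m2 (compLp_min_ae_le h0 G.1)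
      (compLp_min_ae_le h0 G.2)) (dense_squareIntegrable D F)
  rw [mem_ofPred_eq, hTF] at hall
  exact hall

end WentzellResolvent

theorem mainTheorem4 (N : ℕ) (hN : 2 ≤ N) (D : Set (EuclideanSpace ℝ (Fin N)))
    (hD : WentzellResolvent.IsSmoothBoundedDomain D) (ε δ : ℝ) (hε : 0 ≤ ε) (hδ : 0 < δ) :
    (∃! R : WentzellResolvent.L1Space D →L[ℝ] WentzellResolvent.L1Space D,
      WentzellResolvent.IsResolventL1 D ε δ R) ∧
    ∀ R : WentzellResolvent.L1Space D →L[ℝ] WentzellResolvent.L1Space D,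
      WentzellResolvent.IsResolventL1 D ε δ R →
      ∀ c₁ c₂ : ℝ, 0 < c₁ → 0 < c₂ →
      ∀ (f : Lp ℝ 1 (WentzellResolvent.bulkMeasure D))
        (g : Lp ℝ 1 (WentzellResolvent.surfaceMeasure D)),
        (∀ᵐ x ∂(WentzellResolvent.bulkMeasure D), f x ≤ c₁) →
        (∀ᵐ x ∂(WentzellResolvent.surfaceMeasure D), g x ≤ c₂) →
        (∀ᵐ x ∂(WentzellResolvent.bulkMeasure D), (R (f, g)).1 x ≤ max c₁ c₂) ∧
        (∀ᵐ x ∂(WentzellResolvent.surfaceMeasure D), (R (f, g)).2 x ≤ max c₁ c₂) := by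
  refine ⟨?_, fun R hR c₁ c₂ hc₁ _ f g hf hg => ?_⟩
  · obtain ⟨R, hR⟩ := WentzellResolvent.exists_isResolventL1 hD hε hδ
    exact ⟨R, hR, fun S hS => hS.unique hD hε hδ hR⟩
  · exact hR.ae_le hD hε hδ (lt_max_of_lt_left hc₁)
      (hf.mono fun x hx => hx.trans (le_max_left _ _))
      (hg.mono fun x hx => hx.trans (le_max_right _ _))
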